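/- For a density matrix $\rho$ on a finite-dimensional Hilbert space let $S(\rho)=-\mathrm{Tr}(\rho\log\rho)$ be its von Neumann entropy (natural logarithm, $0\log 0=0$); for a fixed state write $S_X$ for the entropy of its reduced state on a subsystem $X$. The bipartite and tripartite entanglement of purification of $\rho_{AB}$ and $\rho_{ABC}$ are $$E_p^{(2)}(A:B)=\inf_{|\psi\rangle_{A\tilde A B\tilde B}}\big[S_{A\tilde A}+S_{B\tilde B}\big],\qquad E_p^{(3)}(A:B:C)=\inf_{|\psi\rangle_{A\tilde A B\tilde B C\tilde C}}\big[S_{A\tilde A}+S_{B\tilde B}+S_{C\tilde C}\big],$$ where the infimum is over all purifications $|\psi\rangle$ of $\rho_{AB}$ (respectively $\rho_{ABC}$), with auxiliary systems $\tilde A,\tilde B,\tilde C$ of arbitrary finite dimensions. The tripartite entanglement signal of $\rho_{ABC}$ is $$\Delta_p^{(3)}(A:B:C)=E_p^{(3)}(A:B:C)-\tfrac12\Big[E_p^{(2)}(A:BC)+E_p^{(2)}(B:AC)+E_p^{(2)}(C:AB)\Big].$$ Let $n\ge 1$ and let $|W_n\rangle=\frac1{\sqrt n}\big(|10\cdots0\rangle+|010\cdots0\rangle+\cdots+|0\cdots01\rangle\big)$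 be the $W$ state of $n$ qubits. (1) For every set of $k$ of the $n$ qubits, $0\le k\le n$, the reduced state of $|W_n\rangle$ on these qubits has von Neumann entropy $$-\frac kn\log\frac kn-\frac{n-k}n\log\frac{n-k}n .$$ (2) Let $A,B,C$ be pairwise disjoint sets of qubits with $|A|=|B|=|C|=1$ (so that $n\ge 3$). Then, for the reduced state $\rho_{ABC}$ of $|W_n\rangle$, $$4\,(S_{AB}-S_A)\ \ge\ \Delta_p^{(3)}(A:B:C)\ \ge\ 0 .$$ -/

import Mathlib

namespace QInfo

open scoped ComplexOrder

/-- A density matrix on the finite-dimensional Hilbert space `ℂ^ι`. -/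
structure DensityMatrix (ι : Type*) [Fintype ι] where
  /-- The underlying complex matrix. -/
  mat : Matrix ι ι ℂ
  posSemidef : mat.PosSemidef
  trace_eq_one : mat.trace = 1

namespace DensityMatrix

variable {ι κ : Type*} [Fintype ι] [Fintype κ]

/-- The von Neumann entropy `-Tr (ρ log ρ)` (natural logarithm): the Shannon entropy of the
eigenvalues of `ρ`, counted with multiplicity. -/
noncomputable def entropy [DecidableEq ι] (ρ : DensityMatrix ι) : ℝ :=
  ∑ i, Real.negMulLog (ρ.posSemidef.isHermitian.eigenvalues i)

/-- The same density matrix with its basis relabelled along a bijection. -/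
def reindex (e : ι ≃ κ) (ρ : DensityMatrix ι) : DensityMatrix κ where
  mat := ρ.mat.submatrix e.symm e.symm
  posSemidef := ρ.posSemidef.submatrix e.symm
  trace_eq_one := by
    rw [← ρ.trace_eq_one]
    exact Equiv.sum_comp e.symm (fun i => ρ.mat i i)

/-- The partial trace over the second tensor factor. -/
def traceRight (ρ : DensityMatrix (ι × κ)) : DensityMatrix ι where
  mat := Matrix.of fun i j => ∑ k, ρ.mat (i, k) (j, k)
  posSemidef := by
    have h : (Matrix.of fun i j => ∑ k, ρ.mat (i, k) (j, k)) =
        ∑ k, ρ.mat.submatrix (fun i => (i, k)) (fun i => (i, k)) := by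
      ext i j
      simp [Matrix.sum_apply]
    rw [h]
    exact Matrix.posSemidef_sum _ fun k _ => ρ.posSemidef.submatrix _
  trace_eq_one := by
    rw [← ρ.trace_eq_one]
    simp [Matrix.trace, Fintype.sum_prod_type]

/-- The reduced state on `ℂ^κ` of a state on `ℂ^ι`, with respect to an identification
`ℂ^ι ≃ ℂ^κ ⊗ ℂ^μ` of product bases. -/
def marginal {μ : Type*} [Fintype μ] (e : ι ≃ κ × μ) (ρ : DensityMatrix ι) : DensityMatrix κ :=
  (ρ.reindex e).traceRight

/-- The pure state `|ψ⟩⟨ψ|` of a unit vector. -/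
def pureState (ψ : EuclideanSpace ℂ ι) (hψ : ‖ψ‖ = 1) : DensityMatrix ι where
  mat := Matrix.vecMulVec ψ (star (ψ : ι → ℂ))
  posSemidef := Matrix.posSemidef_vecMulVec_self_star _
  trace_eq_one := by
    have h : ∑ i, ‖ψ i‖ ^ 2 = 1 := by rw [← EuclideanSpace.norm_sq_eq, hψ, one_pow]
    simp only [Matrix.trace, Matrix.diag_apply, Matrix.vecMulVec_apply, Pi.star_apply,
      RCLike.star_def, Complex.mul_conj']
    exact_mod_cast h

end DensityMatrix

open DensityMatrix

section EntanglementOfPurification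

variable {A B C K L M : Type*}

/-- `A Ã B B̃ ≃ (A B) (Ã B̃)`. -/
def regroup₂ : (A × K) × (B × L) ≃ (A × B) × (K × L) where
  toFun x := ((x.1.1, x.2.1), (x.1.2, x.2.2))
  invFun x := ((x.1.1, x.2.1), (x.1.2, x.2.2))
  left_inv _ := rfl
  right_inv _ := rfl

/-- `A Ã B B̃ C C̃ ≃ (A B C) (Ã B̃ C̃)`. -/
def regroup₃ : (A × K) × (B × L) × (C × M) ≃ (A × B × C) × (K × L × M) where
  toFun x := ((x.1.1, x.2.1.1, x.2.2.1), (x.1.2, x.2.1.2, x.2.2.2))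
  invFun x := ((x.1.1, x.2.1), (x.1.2.1, x.2.2.1), (x.1.2.2, x.2.2.2))
  left_inv _ := rfl
  right_inv _ := rfl

/-- `A B C ≃ B (A C)`: brings the second factor to the front. -/
def secondFirst : A × B × C ≃ B × A × C where
  toFun x := (x.2.1, x.1, x.2.2)
  invFun x := (x.2.1, x.1, x.2.2)
  left_inv _ := rfl
  right_inv _ := rfl

/-- `A B C ≃ C (A B)`: brings the third factor to the front. -/
def thirdFirst : A × B × C ≃ C × A × B where
  toFun x := (x.2.2, x.1, x.2.1)
  invFun x := (x.2.1, x.2.2, x.1)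
  left_inv _ := rfl
  right_inv _ := rfl

variable [Fintype A] [Fintype B] [Fintype C] [DecidableEq A] [DecidableEq B] [DecidableEq C]

/-- All values `S(AÃ) + S(BB̃)` over the purifications `|ψ⟩` of `ρ_AB` on `A Ã B B̃`, with
auxiliary systems `Ã, B̃` of arbitrary finite dimensions. -/
def purificationValues₂ (ρ : DensityMatrix (A × B)) : Set ℝ :=
  {s | ∃ (k l : ℕ) (ψ : EuclideanSpace ℂ ((A × Fin k) × (B × Fin l))) (hψ : ‖ψ‖ = 1),
    (pureState ψ hψ).marginal regroup₂ = ρ ∧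
    s = ((pureState ψ hψ).marginal (Equiv.refl _)).entropy
      + ((pureState ψ hψ).marginal (Equiv.prodComm _ _)).entropy}

/-- All values `S(AÃ) + S(BB̃) + S(CC̃)` over the purifications `|ψ⟩` of `ρ_ABC` on
`A Ã B B̃ C C̃`, with auxiliary systems `Ã, B̃, C̃` of arbitrary finite dimensions. -/
def purificationValues₃ (ρ : DensityMatrix (A × B × C)) : Set ℝ :=
  {s | ∃ (k l m : ℕ) (ψ : EuclideanSpace ℂ ((A × Fin k) × (B × Fin l) × (C × Fin m)))
      (hψ : ‖ψ‖ = 1),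
    (pureState ψ hψ).marginal regroup₃ = ρ ∧
    s = ((pureState ψ hψ).marginal (Equiv.refl _)).entropy
      + ((pureState ψ hψ).marginal secondFirst).entropy
      + ((pureState ψ hψ).marginal thirdFirst).entropy}

/-- The bipartite entanglement of purification `E_p^{(2)}(A : B)`. -/
noncomputable def eop₂ (ρ : DensityMatrix (A × B)) : ℝ := sInf (purificationValues₂ ρ)

/-- The tripartite entanglement of purification `E_p^{(3)}(A : B : C)`. -/
noncomputable def eop₃ (ρ : DensityMatrix (A × B × C)) : ℝ := sInf (purificationValues₃ ρ)

/-- The tripartite entanglement signal `Δ_p^{(3)}(A : B : C)`, that is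
`E_p^{(3)}(A:B:C) - (E_p^{(2)}(A:BC) + E_p^{(2)}(B:AC) + E_p^{(2)}(C:AB)) / 2`. -/
noncomputable def signal₃ (ρ : DensityMatrix (A × B × C)) : ℝ :=
  eop₃ ρ - (eop₂ ρ + eop₂ (ρ.reindex secondFirst) + eop₂ (ρ.reindex thirdFirst)) / 2

end EntanglementOfPurification

section WellDefined

/-! The two infima above are over non-empty sets that are bounded below. -/

variable {A B C ι : Type*} [Fintype A] [Fintype B] [Fintype C] [Fintype ι]
  [DecidableEq A] [DecidableEq B] [DecidableEq C]

theorem DensityMatrix.entropy_nonneg [DecidableEq ι] (ρ : DensityMatrix ι) : 0 ≤ ρ.entropy := by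
  have h0 := ρ.posSemidef.eigenvalues_nonneg
  have h1 : ∑ i, ρ.posSemidef.isHermitian.eigenvalues i = 1 := by
    have h := ρ.posSemidef.isHermitian.trace_eq_sum_eigenvalues
    rw [ρ.trace_eq_one] at h
    simpa using (congrArg Complex.re h).symm
  refine Finset.sum_nonneg fun i _ => Real.negMulLog_nonneg (h0 i) ?_
  rw [← h1]
  exact Finset.single_le_sum (fun j _ => h0 j) (Finset.mem_univ i)

theorem bddBelow_purificationValues₂ (ρ : DensityMatrix (A × B)) :
    BddBelow (purificationValues₂ ρ) := by
  refine ⟨0, ?_⟩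
  rintro s ⟨k, l, ψ, hψ, -, rfl⟩
  exact add_nonneg (entropy_nonneg _) (entropy_nonneg _)

theorem bddBelow_purificationValues₃ (ρ : DensityMatrix (A × B × C)) :
    BddBelow (purificationValues₃ ρ) := by
  refine ⟨0, ?_⟩
  rintro s ⟨k, l, m, ψ, hψ, -, rfl⟩
  exact add_nonneg (add_nonneg (entropy_nonneg _) (entropy_nonneg _)) (entropy_nonneg _)

theorem DensityMatrix.ext' {ρ σ : DensityMatrix ι} (h : ρ.mat = σ.mat) : ρ = σ := by
  cases ρ; cases σ; cases h; rfl

theorem DensityMatrix.exists_factor (ρ : DensityMatrix ι) :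
    ∃ (m : ℕ) (F : ι → Fin m → ℂ), ∀ i j, ρ.mat i j = ∑ t, F i t * star (F j t) := by
  obtain ⟨m, v, hv⟩ := Matrix.posSemidef_iff_eq_sum_vecMulVec.mp ρ.posSemidef
  refine ⟨m, fun i t => v t i, fun i j => ?_⟩
  rw [hv, Matrix.sum_apply]
  rfl

theorem DensityMatrix.sum_factor {ρ : DensityMatrix ι} {τ : Type*} [Fintype τ] {F : ι → τ → ℂ}
    (h : ∀ i j, ρ.mat i j = ∑ t, F i t * star (F j t)) : ∑ i, ∑ t, ‖F i t‖ ^ 2 = 1 := by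
  have h1 := ρ.trace_eq_one
  simp only [Matrix.trace, Matrix.diag_apply, h, RCLike.star_def, Complex.mul_conj'] at h1
  exact_mod_cast h1

theorem norm_eq_one_of_sum {ψ : EuclideanSpace ℂ ι} (h : ∑ i, ‖ψ i‖ ^ 2 = 1) : ‖ψ‖ = 1 := by
  rw [EuclideanSpace.norm_eq, h, Real.sqrt_one]

theorem nonempty_purificationValues₂ (ρ : DensityMatrix (A × B)) :
    (purificationValues₂ ρ).Nonempty := by
  obtain ⟨m, F, hF⟩ := ρ.exists_factor
  let ψ : EuclideanSpace ℂ ((A × Fin m) × (B × Fin 1)) :=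
    WithLp.toLp 2 fun x => F (x.1.1, x.2.1) x.1.2
  have hψ : ‖ψ‖ = 1 := by
    apply norm_eq_one_of_sum
    rw [← sum_factor hF, ← (regroup₂ (A := A) (B := B)).symm.sum_comp]
    simp [ψ, Fintype.sum_prod_type, regroup₂]
  refine ⟨_, _, 1, ψ, hψ, ?_, rfl⟩
  apply DensityMatrix.ext'
  ext i j
  rw [hF]
  simp [marginal, reindex, traceRight, pureState, ψ, Fintype.sum_prod_type, regroup₂,
    Matrix.vecMulVec_apply]

theorem nonempty_purificationValues₃ (ρ : DensityMatrix (A × B × C)) :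
    (purificationValues₃ ρ).Nonempty := by
  obtain ⟨m, F, hF⟩ := ρ.exists_factor
  let ψ : EuclideanSpace ℂ
      ((A × Fin m) × (B × Fin 1) × (C × Fin 1)) :=
    WithLp.toLp 2 fun x => F (x.1.1, x.2.1.1, x.2.2.1) x.1.2
  have hψ : ‖ψ‖ = 1 := by
    apply norm_eq_one_of_sum
    rw [← sum_factor hF, ← (regroup₃ (A := A) (B := B) (C := C)).symm.sum_comp]
    simp [ψ, Fintype.sum_prod_type, regroup₃]
  refine ⟨_, _, 1, 1, ψ, hψ, ?_, rfl⟩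
  apply DensityMatrix.ext'
  ext i j
  rw [hF]
  simp [marginal, reindex, traceRight, pureState, ψ, Fintype.sum_prod_type, regroup₃,
    Matrix.vecMulVec_apply]

end WellDefined

section Qubits

variable {n : ℕ}

/-- The state `|W_n⟩ = (|10⋯0⟩ + |010⋯0⟩ + ⋯ + |0⋯01⟩) / √n` of `n` qubits; the basis of
`(ℂ²)^{⊗ n}` is indexed by bit strings `Fin n → Fin 2`. -/
noncomputable def wVector (n : ℕ) : EuclideanSpace ℂ (Fin n → Fin 2) :=
  ((1 / Real.sqrt n : ℝ) : ℂ) • ∑ i, EuclideanSpace.single (Pi.single i 1) 1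

theorem norm_wVector (hn : 0 < n) : ‖wVector n‖ = 1 := by
  have horth : Orthonormal ℂ (fun i : Fin n =>
      EuclideanSpace.single (Pi.single i 1 : Fin n → Fin 2) (1 : ℂ)) := by
    refine (EuclideanSpace.orthonormal_single (𝕜 := ℂ) (ι := Fin n → Fin 2)).comp
      (fun i => Pi.single i 1) ?_
    intro i j hij
    by_contra hne
    have := congrFun hij i
    simp [Pi.single_eq_of_ne hne] at this
  have hs : ‖∑ i : Fin n, EuclideanSpace.single (Pi.single i 1 : Fin n → Fin 2) (1 : ℂ)‖ ^ 2
      = n := by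
    have h := horth.inner_sum (fun _ => (1 : ℂ)) (fun _ => (1 : ℂ)) Finset.univ
    simp only [one_smul] at h
    rw [inner_self_eq_norm_sq_to_K] at h
    simp only [map_one, mul_one, Finset.sum_const, Finset.card_univ, Fintype.card_fin,
      nsmul_eq_mul] at h
    have h' := congrArg Complex.re h
    simpa [← Complex.ofReal_pow] using h'
  have hs' : ‖∑ i : Fin n, EuclideanSpace.single (Pi.single i 1 : Fin n → Fin 2) (1 : ℂ)‖
      = Real.sqrt n := by
    rw [← hs, Real.sqrt_sq (norm_nonneg _)]
  have hpos : (0 : ℝ) < Real.sqrt n := Real.sqrt_pos.mpr (by exact_mod_cast hn)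
  rw [wVector, norm_smul, hs', Complex.norm_real, Real.norm_of_nonneg (by positivity)]
  field_simp

/-- The pure state `|W_n⟩⟨W_n|`. -/
noncomputable def wState (n : ℕ) (hn : 0 < n) : DensityMatrix (Fin n → Fin 2) :=
  pureState (wVector n) (norm_wVector hn)

/-- The reduced state of an `n`-qubit state on the qubits in `T`. -/
def reduceTo (ρ : DensityMatrix (Fin n → Fin 2)) (T : Finset (Fin n)) :
    DensityMatrix (T → Fin 2) :=
  ρ.marginal (Equiv.piEquivPiSubtypeProd (fun i => i ∈ T) (fun _ => Fin 2))

/-- The reduced state `ρ_ABC` of an `n`-qubit state on three pairwise disjoint sets of qubits,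
as a tripartite state. -/
def reduceTo₃ (ρ : DensityMatrix (Fin n → Fin 2)) (A B C : Finset (Fin n))
    (hAB : Disjoint A B) (hAC : Disjoint A C) (hBC : Disjoint B C) :
    DensityMatrix ((A → Fin 2) × (B → Fin 2) × (C → Fin 2)) :=
  (reduceTo ρ (A ∪ (B ∪ C))).reindex
    (((Equiv.refl _).prodCongr (Equiv.piFinsetUnion (fun _ => Fin 2) hBC)).trans
      (Equiv.piFinsetUnion (fun _ => Fin 2)
        (Finset.disjoint_union_right.mpr ⟨hAB, hAC⟩))).symm

end Qubits

end QInfo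

/-! The lower bound holds for every tripartite state. A purification on AÃ, BB̃, CC̃ is also a
purification for each cut such as A : BC, with B̃C̃ as the second auxiliary system. The two sides of
a pure state have equal entropy, so its value for that cut is 2 S(AÃ). Hence `eop₂` is at most 2
S(AÃ), and half the sum over the three cuts is at most the tripartite value (`signal₃_nonneg`).

For the upper bound, write S₁ and S₂ for the entropies of one and of two qubits of W. Letting à
purify everything, with B̃ and C̃ trivial, gives E_p(A:B:C) ≤ S(BC) + S(B) + S(C) = S₂ + 2 S₁
(`eop₃_le`). Conversely E_p(A:BC) ≥ I(A:B) + I(A:C) = 4 S₁ - 2 S₂ (`mutualInformation_add_le_eop₂`),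
and likewise for the other cuts. Together these bound the signal by S₂ + 2 S₁ - (3/2)(4 S₁ - 2 S₂) =
4 (S₂ - S₁).

The mutual information bound follows from three instances of strong subadditivity, which is proved
here from monotonicity of relative entropy. The relative entropy is an integral over r of r ⟨ρ - σ,
(r L_σ + (1-r) R_ρ)⁻¹ (ρ - σ)⟩, and each such inner product is a supremum of concave quadratic
functionals of a matrix Y. Under a multiplicative `*`-map Φ compatible with the traces, the
functional of the reduced pair at Y is that of the original pair at Φ Y, so the supremum can only
drop under reduction.

The entropies of W come from its Schmidt rank being at most two: across any cut the amplitude matrix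
factors through the Hamming weight 0 or 1 of one side (`gramEntropy_wAmplitude`). -/

namespace QInfo

open Matrix DensityMatrix

open scoped ComplexOrder

/-! ### Entropy through the characteristic polynomial -/

section SpectralEntropy

variable {ι κ μ : Type*} [Fintype ι] [Fintype κ] [Fintype μ]
  [DecidableEq ι] [DecidableEq κ] [DecidableEq μ]

/-- The sum of `-x log x` over the (real parts of the) eigenvalues of a square matrix, counted
with algebraic multiplicity. -/
noncomputable def spectralEntropy (M : Matrix ι ι ℂ) : ℝ :=
  (M.charpoly.roots.map fun z => Real.negMulLog z.re).sum

theorem DensityMatrix.entropy_eq_spectralEntropy (ρ : DensityMatrix ι) :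
    ρ.entropy = spectralEntropy ρ.mat := by
  rw [spectralEntropy, ρ.posSemidef.isHermitian.roots_charpoly_eq_eigenvalues]
  simp [DensityMatrix.entropy]

theorem sum_map_negMulLog_roots_X_pow_mul {p : Polynomial ℂ} (hp : p ≠ 0) (k : ℕ) :
    ((Polynomial.X ^ k * p).roots.map fun z : ℂ => Real.negMulLog z.re).sum =
      (p.roots.map fun z : ℂ => Real.negMulLog z.re).sum := by
  rw [Polynomial.roots_mul (mul_ne_zero (pow_ne_zero _ Polynomial.X_ne_zero) hp),
    Polynomial.roots_X_pow]
  simp [Multiset.map_nsmul, Multiset.sum_nsmul]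

/-- The characteristic polynomials of AB and BA agree up to powers of X, and the extra roots 0
contribute nothing since 0 log 0 = 0. This is the source of every change of system below. -/
theorem spectralEntropy_mul_comm (A : Matrix ι κ ℂ) (B : Matrix κ ι ℂ) :
    spectralEntropy (A * B) = spectralEntropy (B * A) := by
  rw [spectralEntropy, spectralEntropy,
    ← sum_map_negMulLog_roots_X_pow_mul (A * B).charpoly_monic.ne_zero (Fintype.card κ),
    charpoly_mul_comm', sum_map_negMulLog_roots_X_pow_mul (B * A).charpoly_monic.ne_zero]

theorem spectralEntropy_transpose (M : Matrix ι ι ℂ) :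
    spectralEntropy Mᵀ = spectralEntropy M := by
  rw [spectralEntropy, charpoly_transpose, spectralEntropy]

theorem spectralEntropy_submatrix (M : Matrix ι ι ℂ) (e : κ ≃ ι) :
    spectralEntropy (M.submatrix e e) = spectralEntropy M := by
  rw [spectralEntropy, spectralEntropy, ← charpoly_reindex e.symm M]
  rfl

theorem spectralEntropy_diagonal (a : ι → ℝ) :
    spectralEntropy (diagonal fun i => (a i : ℂ)) = ∑ i, Real.negMulLog (a i) := by
  rw [spectralEntropy, charpoly_diagonal, Polynomial.roots_prod]
  · simp
  · simp [Finset.prod_ne_zero_iff, Polynomial.X_sub_C_ne_zero]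

/-- `M` is diagonalized by the unitary matrix `U`, with real eigenvalues `a`. -/
structure IsSpectralDecomposition (M : Matrix ι ι ℂ) (U : Matrix ι κ ℂ) (a : κ → ℝ) : Prop where
  mul_conjTranspose : U * Uᴴ = 1
  conjTranspose_mul : Uᴴ * U = 1
  eq : M = U * diagonal (fun i => (a i : ℂ)) * Uᴴ

theorem IsSpectralDecomposition.spectralEntropy_eq {M : Matrix ι ι ℂ} {U : Matrix ι κ ℂ}
    {a : κ → ℝ} (h : IsSpectralDecomposition M U a) :
    spectralEntropy M = ∑ i, Real.negMulLog (a i) := by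
  rw [h.eq, spectralEntropy_mul_comm, ← Matrix.mul_assoc, h.conjTranspose_mul, Matrix.one_mul,
    spectralEntropy_diagonal]

theorem IsSpectralDecomposition.add_smul_one {M : Matrix ι ι ℂ} {U : Matrix ι κ ℂ}
    {a : κ → ℝ} (h : IsSpectralDecomposition M U a) (c : ℝ) :
    IsSpectralDecomposition (M + (c : ℂ) • (1 : Matrix ι ι ℂ)) U (fun i => a i + c) := by
  refine ⟨h.mul_conjTranspose, h.conjTranspose_mul, ?_⟩
  have hd : (diagonal fun i => ((a i + c : ℝ) : ℂ)) =
      diagonal (fun i => (a i : ℂ)) + (c : ℂ) • (1 : Matrix κ κ ℂ) := by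
    rw [smul_one_eq_diagonal, diagonal_add]
    simp
  rw [hd, Matrix.mul_add, Matrix.add_mul, ← h.eq, Matrix.mul_smul, Matrix.mul_one,
    Matrix.smul_mul, h.mul_conjTranspose]

theorem exists_isSpectralDecomposition {M : Matrix ι ι ℂ} (hM : M.PosSemidef) :
    ∃ (U : Matrix ι ι ℂ) (a : ι → ℝ), IsSpectralDecomposition M U a ∧ ∀ i, 0 ≤ a i := by
  refine ⟨hM.isHermitian.eigenvectorUnitary, hM.isHermitian.eigenvalues, ⟨?_, ?_, ?_⟩,
    hM.eigenvalues_nonneg⟩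
  · exact Unitary.coe_mul_star_self _
  · exact Unitary.coe_star_mul_self _
  · conv_lhs => rw [hM.isHermitian.spectral_theorem, Unitary.conjStarAlgAut_apply]
    rfl

/-- The entropy of the reduced state on the first factor of the bipartite vector with amplitudes
`F`. -/
noncomputable def gramEntropy (F : Matrix ι κ ℂ) : ℝ := spectralEntropy (F * Fᴴ)

/-- The two marginals of a bipartite pure state have the same entropy. -/
theorem gramEntropy_transpose (F : Matrix ι κ ℂ) : gramEntropy Fᵀ = gramEntropy F := by
  rw [gramEntropy, gramEntropy, spectralEntropy_mul_comm, ← spectralEntropy_transpose,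
    Matrix.transpose_mul, transpose_transpose]
  rfl

omit [DecidableEq κ] in
theorem gramEntropy_submatrix {ι' κ' : Type*} [Fintype ι'] [Fintype κ'] [DecidableEq ι']
    (F : Matrix ι κ ℂ) (e : ι' ≃ ι) (f : κ' ≃ κ) :
    gramEntropy (F.submatrix e f) = gramEntropy F := by
  rw [gramEntropy, gramEntropy, ← spectralEntropy_submatrix _ e, conjTranspose_submatrix,
    submatrix_mul_equiv]

end SpectralEntropy

end QInfo

namespace QInfo

open Matrix DensityMatrix

/-! ### Integral and variational formulas for relative entropy; monotonicity -/

section RelativeEntropy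

theorem convexCombination_pos {a b r : ℝ} (ha : 0 < a) (hb : 0 < b) (hr : r ∈ Set.Icc (0 : ℝ) 1) :
    0 < r * b + (1 - r) * a := by
  rcases hr.1.eq_or_lt with h | h
  · simpa [← h] using ha
  · exact add_pos_of_pos_of_nonneg (mul_pos h hb) (mul_nonneg (sub_nonneg.mpr hr.2) ha.le)

theorem intervalIntegrable_sq_sub_div {a b : ℝ} (ha : 0 < a) (hb : 0 < b) :
    IntervalIntegrable (fun r : ℝ => r * ((a - b) ^ 2 / (r * b + (1 - r) * a)))
      MeasureTheory.volume 0 1 := by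
  refine ContinuousOn.intervalIntegrable fun r hr => ContinuousAt.continuousWithinAt ?_
  rw [Set.uIcc_of_le zero_le_one] at hr
  have := (convexCombination_pos ha hb hr).ne'
  fun_prop (disch := assumption)

theorem integral_sq_sub_div {a b : ℝ} (ha : 0 < a) (hb : 0 < b) :
    ∫ r in (0 : ℝ)..1, r * ((a - b) ^ 2 / (r * b + (1 - r) * a)) =
      a * Real.log (a / b) - a + b := by
  -- With c = r b + (1 - r) a one has c - a = r (b - a), so (b - a) - a (b - a) / c is the
  -- integrand.
  have hderiv : ∀ r ∈ Set.uIcc (0 : ℝ) 1, HasDerivAt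
      (fun r => r * (b - a) - a * Real.log (r * b + (1 - r) * a))
      (r * ((a - b) ^ 2 / (r * b + (1 - r) * a))) r := by
    intro r hr
    rw [Set.uIcc_of_le zero_le_one] at hr
    have hpos := (convexCombination_pos ha hb hr).ne'
    have h1 : HasDerivAt (fun r : ℝ => r * b + (1 - r) * a) (b - a) r := by
      have := ((hasDerivAt_id' r).mul_const b).add (((hasDerivAt_id' r).const_sub 1).mul_const a)
      exact this.congr_deriv (by ring)
    have h2 := ((hasDerivAt_id' r).mul_const (b - a)).sub ((h1.log hpos).const_mul a)
    refine h2.congr_deriv ?_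
    clear h1 h2
    generalize hc : r * b + (1 - r) * a = c at hpos ⊢
    rw [one_mul, sub_eq_iff_eq_add, ← mul_div_assoc, ← mul_div_assoc, ← add_div, eq_div_iff hpos,
      ← hc]
    ring
  rw [intervalIntegral.integral_eq_sub_of_hasDerivAt hderiv (intervalIntegrable_sq_sub_div ha hb),
    Real.log_div ha.ne' hb.ne']
  simp
  ring

/-- Completing the square, ‖c z - d w‖² ≥ 0. Equality holds at z = (d / c) w, the choice made in
`two_mul_re_sub_eq`. -/
theorem two_mul_re_sub_le {c : ℝ} (hc : 0 < c) (d : ℝ) (z w : ℂ) :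
    2 * d * (star z * w).re - c * ‖z‖ ^ 2 ≤ ‖w‖ ^ 2 * (d ^ 2 / c) := by
  rw [← mul_div_assoc, le_div_iff₀ hc]
  simp only [← Complex.normSq_eq_norm_sq, Complex.normSq_apply, Complex.star_def, Complex.mul_re,
    Complex.conj_re, Complex.conj_im]
  nlinarith [sq_nonneg (c * z.re - d * w.re), sq_nonneg (c * z.im - d * w.im)]

theorem two_mul_re_sub_eq {c : ℝ} (hc : 0 < c) (d : ℝ) (w : ℂ) :
    2 * d * (star (((d / c : ℝ) : ℂ) * w) * w).re - c * ‖((d / c : ℝ) : ℂ) * w‖ ^ 2 =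
      ‖w‖ ^ 2 * (d ^ 2 / c) := by
  simp only [← Complex.normSq_eq_norm_sq, Complex.normSq_apply, Complex.star_def, Complex.mul_re,
    Complex.mul_im, Complex.conj_re, Complex.conj_im, Complex.ofReal_re, Complex.ofReal_im]
  field_simp
  ring

variable {m n I J I' J' : Type*} [Fintype m] [Fintype n] [Fintype I] [Fintype J] [Fintype I']
  [Fintype J'] [DecidableEq m] [DecidableEq n] [DecidableEq I] [DecidableEq J] [DecidableEq I']
  [DecidableEq J']

/-- The concave quadratic functional of `Y` whose supremum is
`⟨ρ - σ, (r L_σ + (1 - r) R_ρ)⁻¹ (ρ - σ)⟩`, where `L` and `R` denote left and right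
multiplication. -/
noncomputable def divergenceForm (r : ℝ) (ρ σ Y : Matrix n n ℂ) : ℝ :=
  2 * (trace (Yᴴ * ρ) - trace (Yᴴ * σ)).re - r * (trace (Y * Yᴴ * σ)).re
    - (1 - r) * (trace (Yᴴ * Y * ρ)).re

/-- The relative entropy of two positive definite matrices with eigenvalues `a` and `b`,
where `W` is the matrix of inner products of the eigenvectors. -/
noncomputable def spectralDivergence (W : Matrix J I ℂ) (a : I → ℝ) (b : J → ℝ) : ℝ :=
  ∑ j, ∑ i, ‖W j i‖ ^ 2 * (a i * Real.log (a i / b j) - a i + b j)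

omit [DecidableEq I] [DecidableEq J] in
theorem intervalIntegrable_sum_sq_sub_div (W : Matrix J I ℂ) {a : I → ℝ} {b : J → ℝ}
    (ha : ∀ i, 0 < a i) (hb : ∀ j, 0 < b j) :
    IntervalIntegrable (fun r : ℝ => ∑ x : J × I,
      ‖W x.1 x.2‖ ^ 2 * (r * ((a x.2 - b x.1) ^ 2 / (r * b x.1 + (1 - r) * a x.2))))
      MeasureTheory.volume 0 1 := by
  have h := IntervalIntegrable.sum Finset.univ fun (x : J × I) _ =>
    (intervalIntegrable_sq_sub_div (ha x.2) (hb x.1)).const_mul (‖W x.1 x.2‖ ^ 2)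
  rwa [Finset.sum_fn] at h

omit [DecidableEq I] [DecidableEq J] in
theorem mul_sum_sq_sub_div (W : Matrix J I ℂ) (a : I → ℝ) (b : J → ℝ) (r : ℝ) :
    ∑ x : J × I, ‖W x.1 x.2‖ ^ 2 * (r * ((a x.2 - b x.1) ^ 2 / (r * b x.1 + (1 - r) * a x.2))) =
      r * ∑ j, ∑ i, ‖W j i‖ ^ 2 * ((a i - b j) ^ 2 / (r * b j + (1 - r) * a i)) := by
  simp only [Fintype.sum_prod_type, Finset.mul_sum, mul_left_comm]

omit [DecidableEq I] [DecidableEq J] in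
theorem spectralDivergence_eq_integral (W : Matrix J I ℂ) {a : I → ℝ} {b : J → ℝ}
    (ha : ∀ i, 0 < a i) (hb : ∀ j, 0 < b j) :
    spectralDivergence W a b = ∫ r in (0 : ℝ)..1, ∑ x : J × I,
      ‖W x.1 x.2‖ ^ 2 * (r * ((a x.2 - b x.1) ^ 2 / (r * b x.1 + (1 - r) * a x.2))) := by
  rw [intervalIntegral.integral_finsetSum fun x _ =>
    (intervalIntegrable_sq_sub_div (ha x.2) (hb x.1)).const_mul _, spectralDivergence,
    Fintype.sum_prod_type]
  refine Finset.sum_congr rfl fun j _ => Finset.sum_congr rfl fun i _ => ?_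
  rw [intervalIntegral.integral_const_mul, integral_sq_sub_div (ha i) (hb j)]

/-- Left multiplication by σ and right multiplication by ρ are simultaneously diagonal in the
coordinates Z = Vᴴ Y U, so the functional decouples into one scalar quadratic for each entry of Z.
-/
theorem divergenceForm_eq {ρ σ : Matrix n n ℂ} {U : Matrix n I ℂ} {V : Matrix n J ℂ}
    {a : I → ℝ} {b : J → ℝ} (hρ : IsSpectralDecomposition ρ U a)
    (hσ : IsSpectralDecomposition σ V b) (r : ℝ) (Z : Matrix J I ℂ) :
    divergenceForm r ρ σ (V * Z * Uᴴ) = ∑ j, ∑ i,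
      (2 * (a i - b j) * (star (Z j i) * (Vᴴ * U) j i).re
        - (r * b j + (1 - r) * a i) * ‖Z j i‖ ^ 2) := by
  have hU := hρ.conjTranspose_mul
  have hV := hσ.conjTranspose_mul
  have e1 : trace ((V * Z * Uᴴ)ᴴ * ρ) =
      ∑ j, ∑ i, star (Z j i) * (Vᴴ * U) j i * (a i : ℂ) := by
    have : (V * Z * Uᴴ)ᴴ * ρ = U * (Zᴴ * (Vᴴ * U) * diagonal (fun i => (a i : ℂ)) * Uᴴ) := by
      rw [hρ.eq]
      simp only [conjTranspose_mul, conjTranspose_conjTranspose, Matrix.mul_assoc]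
    rw [this, trace_mul_comm, Matrix.mul_assoc _ Uᴴ, hU, Matrix.mul_one, Finset.sum_comm]
    simp only [trace, diag_apply, mul_diagonal, Matrix.mul_apply (M := Zᴴ),
      conjTranspose_apply Z, Finset.sum_mul]
  have e2 : trace ((V * Z * Uᴴ)ᴴ * σ) =
      ∑ j, ∑ i, star (Z j i) * (Vᴴ * U) j i * (b j : ℂ) := by
    have : (V * Z * Uᴴ)ᴴ * σ = U * (Zᴴ * ((Vᴴ * V) * diagonal (fun i => (b i : ℂ)) * Vᴴ)) := by
      rw [hσ.eq]
      simp only [conjTranspose_mul, conjTranspose_conjTranspose, Matrix.mul_assoc]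
    rw [this, trace_mul_comm, hV, Matrix.one_mul, Matrix.mul_assoc, Matrix.mul_assoc,
      Finset.sum_comm]
    simp only [trace, diag_apply, diagonal_mul, Matrix.mul_apply (M := Zᴴ),
      conjTranspose_apply Z]
    refine Finset.sum_congr rfl fun i _ => Finset.sum_congr rfl fun j _ => ?_
    ring
  have e3 : trace ((V * Z * Uᴴ) * (V * Z * Uᴴ)ᴴ * σ) =
      ∑ j, ∑ i, star (Z j i) * Z j i * (b j : ℂ) := by
    have : (V * Z * Uᴴ) * (V * Z * Uᴴ)ᴴ * σ =
        V * (Z * (Uᴴ * U) * Zᴴ * (Vᴴ * V) * diagonal (fun i => (b i : ℂ)) * Vᴴ) := by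
      rw [hσ.eq]
      simp only [conjTranspose_mul, conjTranspose_conjTranspose, Matrix.mul_assoc]
    rw [this, trace_mul_comm, hU, hV, Matrix.mul_one, Matrix.mul_one, Matrix.mul_assoc _ Vᴴ, hV,
      Matrix.mul_one]
    simp only [trace, diag_apply, mul_diagonal, Matrix.mul_apply (M := Z),
      conjTranspose_apply Z, Finset.sum_mul]
    refine Finset.sum_congr rfl fun i _ => Finset.sum_congr rfl fun j _ => ?_
    ring
  have e4 : trace ((V * Z * Uᴴ)ᴴ * (V * Z * Uᴴ) * ρ) =
      ∑ j, ∑ i, star (Z j i) * Z j i * (a i : ℂ) := by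
    have : (V * Z * Uᴴ)ᴴ * (V * Z * Uᴴ) * ρ =
        U * (Zᴴ * (Vᴴ * V) * Z * (Uᴴ * U) * diagonal (fun i => (a i : ℂ)) * Uᴴ) := by
      rw [hρ.eq]
      simp only [conjTranspose_mul, conjTranspose_conjTranspose, Matrix.mul_assoc]
    rw [this, trace_mul_comm, hU, hV, Matrix.mul_one, Matrix.mul_one, Matrix.mul_assoc _ Uᴴ, hU,
      Matrix.mul_one, Finset.sum_comm]
    simp only [trace, diag_apply, mul_diagonal, Matrix.mul_apply (M := Zᴴ),
      conjTranspose_apply Z, Finset.sum_mul]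
  have hz : ∀ j i, (star (Z j i) * Z j i).re = ‖Z j i‖ ^ 2 := fun j i => by
    rw [← Complex.normSq_eq_norm_sq, Complex.normSq_apply]
    simp
  rw [divergenceForm, e1, e2, e3, e4]
  simp only [Complex.sub_re, Complex.re_sum, Complex.re_mul_ofReal, hz, mul_sub, Finset.mul_sum,
    ← Finset.sum_sub_distrib]
  refine Finset.sum_congr rfl fun j _ => Finset.sum_congr rfl fun i _ => ?_
  ring

theorem divergenceForm_le {ρ σ : Matrix n n ℂ} {U : Matrix n I ℂ} {V : Matrix n J ℂ}
    {a : I → ℝ} {b : J → ℝ} (hρ : IsSpectralDecomposition ρ U a)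
    (hσ : IsSpectralDecomposition σ V b) {r : ℝ} (hc : ∀ j i, 0 < r * b j + (1 - r) * a i)
    (Y : Matrix n n ℂ) :
    divergenceForm r ρ σ Y ≤ ∑ j, ∑ i,
      ‖(Vᴴ * U) j i‖ ^ 2 * ((a i - b j) ^ 2 / (r * b j + (1 - r) * a i)) := by
  have hY : Y = V * (Vᴴ * Y * U) * Uᴴ := by
    rw [← Matrix.mul_assoc, ← Matrix.mul_assoc, hσ.mul_conjTranspose, Matrix.one_mul,
      Matrix.mul_assoc, hρ.mul_conjTranspose, Matrix.mul_one]
  rw [hY, divergenceForm_eq hρ hσ]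
  exact Finset.sum_le_sum fun j _ => Finset.sum_le_sum fun i _ => two_mul_re_sub_le (hc j i) _ _ _

theorem exists_divergenceForm_eq {ρ σ : Matrix n n ℂ} {U : Matrix n I ℂ} {V : Matrix n J ℂ}
    {a : I → ℝ} {b : J → ℝ} (hρ : IsSpectralDecomposition ρ U a)
    (hσ : IsSpectralDecomposition σ V b) {r : ℝ} (hc : ∀ j i, 0 < r * b j + (1 - r) * a i) :
    ∃ Y, divergenceForm r ρ σ Y = ∑ j, ∑ i,
      ‖(Vᴴ * U) j i‖ ^ 2 * ((a i - b j) ^ 2 / (r * b j + (1 - r) * a i)) := by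
  refine ⟨V * of (fun j i => (((a i - b j) / (r * b j + (1 - r) * a i) : ℝ) : ℂ) *
    (Vᴴ * U) j i) * Uᴴ, ?_⟩
  rw [divergenceForm_eq hρ hσ]
  exact Finset.sum_congr rfl fun j _ => Finset.sum_congr rfl fun i _ =>
    two_mul_re_sub_eq (hc j i) _ _

/-- Monotonicity of the relative entropy of positive definite matrices under the adjoint of a
multiplicative `*`-map `Φ`. -/
theorem spectralDivergence_mono {ρ σ : Matrix n n ℂ} {U : Matrix n I ℂ} {V : Matrix n J ℂ}
    {a : I → ℝ} {b : J → ℝ} (hρ : IsSpectralDecomposition ρ U a)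
    (hσ : IsSpectralDecomposition σ V b) (ha : ∀ i, 0 < a i) (hb : ∀ j, 0 < b j)
    {ρ' σ' : Matrix m m ℂ} {U' : Matrix m I' ℂ} {V' : Matrix m J' ℂ}
    {a' : I' → ℝ} {b' : J' → ℝ} (hρ' : IsSpectralDecomposition ρ' U' a')
    (hσ' : IsSpectralDecomposition σ' V' b') (ha' : ∀ i, 0 < a' i) (hb' : ∀ j, 0 < b' j)
    (Φ : Matrix m m ℂ → Matrix n n ℂ) (hΦ_star : ∀ Y, (Φ Y)ᴴ = Φ Yᴴ)
    (hΦ_mul : ∀ Y Z, Φ (Y * Z) = Φ Y * Φ Z)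
    (hΦρ : ∀ Y, trace (Φ Y * ρ) = trace (Y * ρ')) (hΦσ : ∀ Y, trace (Φ Y * σ) = trace (Y * σ')) :
    spectralDivergence (V'ᴴ * U') a' b' ≤ spectralDivergence (Vᴴ * U) a b := by
  rw [spectralDivergence_eq_integral _ ha hb, spectralDivergence_eq_integral _ ha' hb']
  refine intervalIntegral.integral_mono_on zero_le_one
    (intervalIntegrable_sum_sq_sub_div _ ha' hb') (intervalIntegrable_sum_sq_sub_div _ ha hb)
    fun r hr => ?_
  rw [mul_sum_sq_sub_div, mul_sum_sq_sub_div]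
  refine mul_le_mul_of_nonneg_left ?_ hr.1
  -- Take the maximizer for the reduced pair and use its image under Φ as a trial matrix for the
  -- original pair.
  obtain ⟨Y, hY⟩ := exists_divergenceForm_eq hρ' hσ' fun j i =>
    convexCombination_pos (ha' i) (hb' j) hr
  rw [← hY]
  refine le_trans (le_of_eq ?_) (divergenceForm_le hρ hσ
    (fun j i => convexCombination_pos (ha i) (hb j) hr) (Φ Y))
  simp only [divergenceForm, hΦ_star, ← hΦ_mul, hΦρ, hΦσ]

end RelativeEntropy

end QInfo

namespace QInfo

set_option linter.unusedSectionVars false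

open Matrix DensityMatrix
open scoped Kronecker ComplexOrder

/-! ### Partial traces and strong subadditivity -/

section StrongSubadditivity

variable {m n I J : Type*} [Fintype m] [Fintype n] [Fintype I] [Fintype J]
  [DecidableEq m] [DecidableEq n] [DecidableEq I] [DecidableEq J]

theorem IsSpectralDecomposition.trace_re {M : Matrix n n ℂ} {U : Matrix n I ℂ} {a : I → ℝ}
    (h : IsSpectralDecomposition M U a) : M.trace.re = ∑ i, a i := by
  rw [h.eq, trace_mul_comm, ← Matrix.mul_assoc, h.conjTranspose_mul, Matrix.one_mul]
  simp [trace]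

theorem IsSpectralDecomposition.one_kronecker {M : Matrix n n ℂ} {U : Matrix n I ℂ} {a : I → ℝ}
    (h : IsSpectralDecomposition M U a) :
    IsSpectralDecomposition ((1 : Matrix m m ℂ) ⊗ₖ M) ((1 : Matrix m m ℂ) ⊗ₖ U)
      (fun x => a x.2) := by
  have hd : diagonal (fun x : m × I => (a x.2 : ℂ)) =
      (1 : Matrix m m ℂ) ⊗ₖ diagonal (fun i => (a i : ℂ)) := by
    rw [← diagonal_one, diagonal_kronecker_diagonal]
    simp
  refine ⟨?_, ?_, ?_⟩
  · rw [conjTranspose_kronecker, ← mul_kronecker_mul, h.mul_conjTranspose]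
    simp
  · rw [conjTranspose_kronecker, ← mul_kronecker_mul, h.conjTranspose_mul]
    simp
  · rw [hd, conjTranspose_kronecker, ← mul_kronecker_mul, ← mul_kronecker_mul, ← h.eq]
    simp

/-- The squared overlaps ‖W j i‖² form a doubly stochastic matrix because W is unitary, so the terms
depending on i alone or on j alone sum freely. Only the cross term Tr ρ log σ keeps the overlaps; it
is read off the diagonal of Vᴴ ρ V. -/
theorem IsSpectralDecomposition.spectralDivergence_eq {ρ : Matrix n n ℂ} {U : Matrix n I ℂ}
    {a : I → ℝ} (h : IsSpectralDecomposition ρ U a) (ha : ∀ i, 0 < a i) {V : Matrix n J ℂ}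
    (hV : V * Vᴴ = 1) (hV' : Vᴴ * V = 1) {b : J → ℝ} (hb : ∀ j, 0 < b j) :
    spectralDivergence (Vᴴ * U) a b = -spectralEntropy ρ
      - ∑ j, Real.log (b j) * ((Vᴴ * ρ * V) j j).re - ∑ i, a i + ∑ j, b j := by
  set W := Vᴴ * U with hW
  have hW1 : W * Wᴴ = 1 := by
    rw [hW, Matrix.conjTranspose_mul, conjTranspose_conjTranspose, Matrix.mul_assoc, ← Matrix.mul_assoc U,
      h.mul_conjTranspose, Matrix.one_mul, hV']
  have hW2 : Wᴴ * W = 1 := by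
    rw [hW, Matrix.conjTranspose_mul, conjTranspose_conjTranspose, Matrix.mul_assoc, ← Matrix.mul_assoc V,
      hV, Matrix.one_mul, h.conjTranspose_mul]
  have hrow : ∀ j, ∑ i, ‖W j i‖ ^ 2 = 1 := fun j => by
    have := congrFun (congrFun hW1 j) j
    simp only [Matrix.mul_apply, conjTranspose_apply, RCLike.star_def, Complex.mul_conj',
      one_apply_eq] at this
    exact_mod_cast this
  have hcol : ∀ i, ∑ j, ‖W j i‖ ^ 2 = 1 := fun i => by
    have := congrFun (congrFun hW2 i) i
    simp only [Matrix.mul_apply, conjTranspose_apply, RCLike.star_def, Complex.conj_mul',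
      one_apply_eq] at this
    exact_mod_cast this
  have hcross : ∀ j, ((Vᴴ * ρ * V) j j).re = ∑ i, ‖W j i‖ ^ 2 * a i := fun j => by
    have : Vᴴ * ρ * V = W * diagonal (fun i => (a i : ℂ)) * Wᴴ := by
      rw [hW, h.eq, Matrix.conjTranspose_mul, conjTranspose_conjTranspose]
      simp only [Matrix.mul_assoc]
    rw [this, Matrix.mul_apply, Complex.re_sum]
    refine Finset.sum_congr rfl fun i _ => ?_
    rw [mul_diagonal, conjTranspose_apply, mul_right_comm, RCLike.star_def, Complex.mul_conj']
    norm_cast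
  have hsplit : spectralDivergence W a b =
      ∑ i, ∑ j, ‖W j i‖ ^ 2 * (a i * Real.log (a i) - a i)
        - ∑ j, Real.log (b j) * ((Vᴴ * ρ * V) j j).re + ∑ j, ∑ i, ‖W j i‖ ^ 2 * b j := by
    rw [Finset.sum_comm]
    simp only [hcross, Finset.mul_sum, spectralDivergence, ← Finset.sum_add_distrib,
      ← Finset.sum_sub_distrib]
    refine Finset.sum_congr rfl fun j _ => Finset.sum_congr rfl fun i _ => ?_
    rw [Real.log_div (ha i).ne' (hb j).ne']
    ring
  rw [hsplit, h.spectralEntropy_eq]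
  simp only [← Finset.sum_mul, hrow, hcol, one_mul, Finset.sum_sub_distrib, Real.negMulLog,
    neg_mul, Finset.sum_neg_distrib, neg_neg]
  ring

/-- The partial trace over the first factor. -/
def traceFst (M : Matrix (m × n) (m × n) ℂ) : Matrix n n ℂ :=
  of fun i j => ∑ k, M (k, i) (k, j)

/-- The partial trace over the second factor. -/
def traceSnd (M : Matrix (m × n) (m × n) ℂ) : Matrix m m ℂ :=
  of fun i j => ∑ k, M (i, k) (j, k)

theorem trace_traceFst (M : Matrix (m × n) (m × n) ℂ) : (traceFst M).trace = M.trace := by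
  simp [trace, traceFst, Fintype.sum_prod_type_right]

theorem trace_traceSnd (M : Matrix (m × n) (m × n) ℂ) : (traceSnd M).trace = M.trace := by
  simp [trace, traceSnd, Fintype.sum_prod_type]

theorem traceFst_eq_sum (M : Matrix (m × n) (m × n) ℂ) :
    traceFst M = ∑ k, M.submatrix (fun i => (k, i)) (fun i => (k, i)) := by
  ext i j
  simp [traceFst, Matrix.sum_apply]

theorem traceSnd_eq_sum (M : Matrix (m × n) (m × n) ℂ) :
    traceSnd M = ∑ k, M.submatrix (fun i => (i, k)) (fun i => (i, k)) := by
  ext i j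
  simp [traceSnd, Matrix.sum_apply]

theorem traceFst_posSemidef {M : Matrix (m × n) (m × n) ℂ} (hM : M.PosSemidef) :
    (traceFst M).PosSemidef := by
  rw [traceFst_eq_sum]
  exact posSemidef_sum _ fun k _ => hM.submatrix _

theorem traceSnd_posSemidef {M : Matrix (m × n) (m × n) ℂ} (hM : M.PosSemidef) :
    (traceSnd M).PosSemidef := by
  rw [traceSnd_eq_sum]
  exact posSemidef_sum _ fun k _ => hM.submatrix _

theorem traceFst_add_smul_one (M : Matrix (m × n) (m × n) ℂ) (c : ℝ) :
    traceFst (M + (c : ℂ) • (1 : Matrix (m × n) (m × n) ℂ)) =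
      traceFst M + ((c * Fintype.card m : ℝ) : ℂ) • (1 : Matrix n n ℂ) := by
  ext i j
  by_cases h : i = j <;> simp [traceFst, Finset.sum_add_distrib, Matrix.one_apply, h, mul_comm]

theorem traceSnd_add_smul_one (M : Matrix (m × n) (m × n) ℂ) (c : ℝ) :
    traceSnd (M + (c : ℂ) • (1 : Matrix (m × n) (m × n) ℂ)) =
      traceSnd M + ((c * Fintype.card n : ℝ) : ℂ) • (1 : Matrix m m ℂ) := by
  ext i j
  by_cases h : i = j <;> simp [traceSnd, Finset.sum_add_distrib, Matrix.one_apply, h, mul_comm]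

theorem trace_kronecker_one_mul (Y : Matrix m m ℂ) (M : Matrix (m × n) (m × n) ℂ) :
    trace ((Y ⊗ₖ (1 : Matrix n n ℂ)) * M) = trace (Y * traceSnd M) := by
  simp only [trace, diag_apply, Matrix.mul_apply, traceSnd, of_apply, kroneckerMap_apply,
    Fintype.sum_prod_type, Matrix.one_apply, Finset.mul_sum]
  refine Finset.sum_congr rfl fun i _ => ?_
  rw [Finset.sum_comm]
  simp

theorem traceFst_one_kronecker_conj (V : Matrix n J ℂ) (M : Matrix (m × n) (m × n) ℂ) :
    traceFst (((1 : Matrix m m ℂ) ⊗ₖ V)ᴴ * M * ((1 : Matrix m m ℂ) ⊗ₖ V)) =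
      Vᴴ * traceFst M * V := by
  rw [traceFst_eq_sum M, Matrix.mul_sum, Matrix.sum_mul]
  ext i j
  rw [traceFst, of_apply, Matrix.sum_apply]
  refine Finset.sum_congr rfl fun k _ => ?_
  simp only [Matrix.mul_apply, kroneckerMap_apply, conjTranspose_apply, submatrix_apply,
    Fintype.sum_prod_type_right, Matrix.one_apply]
  simp [apply_ite star]

/-- The divergence of ρ from 1 ⊗ Tr₁ ρ is minus a conditional entropy: the logarithm of 1 ⊗ Tr₁ ρ
sees only the marginal Tr₁ ρ. The trace correction is there because 1 ⊗ Tr₁ ρ has trace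
`Fintype.card m` times that of ρ. -/
theorem spectralDivergence_one_kronecker {ρ : Matrix (m × n) (m × n) ℂ}
    {U : Matrix (m × n) I ℂ} {a : I → ℝ} (h : IsSpectralDecomposition ρ U a) (ha : ∀ i, 0 < a i)
    {V : Matrix n J ℂ} {b : J → ℝ} (h' : IsSpectralDecomposition (traceFst ρ) V b)
    (hb : ∀ j, 0 < b j) :
    spectralDivergence (((1 : Matrix m m ℂ) ⊗ₖ V)ᴴ * U) a (fun x => b x.2) =
      spectralEntropy (traceFst ρ) - spectralEntropy ρ + (Fintype.card m - 1) * ρ.trace.re := by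
  have h1 := h'.one_kronecker (m := m)
  rw [h.spectralDivergence_eq ha h1.mul_conjTranspose h1.conjTranspose_mul fun x => hb x.2,
    h'.spectralEntropy_eq]
  have hdiag : Vᴴ * traceFst ρ * V = diagonal fun j => (b j : ℂ) := by
    rw [h'.eq, Matrix.mul_assoc, Matrix.mul_assoc, h'.conjTranspose_mul, Matrix.mul_one,
      ← Matrix.mul_assoc, h'.conjTranspose_mul, Matrix.one_mul]
  have hcross : ∑ x : m × J, Real.log (b x.2) *
      ((((1 : Matrix m m ℂ) ⊗ₖ V)ᴴ * ρ * ((1 : Matrix m m ℂ) ⊗ₖ V)) x x).re =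
        ∑ j, Real.log (b j) * b j := by
    rw [Fintype.sum_prod_type_right]
    refine Finset.sum_congr rfl fun j _ => ?_
    dsimp only
    rw [← Finset.mul_sum, ← Complex.re_sum]
    have := congrFun (congrFun (traceFst_one_kronecker_conj V ρ) j) j
    rw [hdiag, diagonal_apply_eq, traceFst, of_apply] at this
    rw [this, Complex.ofReal_re]
  have hb' := h'.trace_re
  rw [trace_traceFst] at hb'
  rw [hcross, ← h.trace_re, Fintype.sum_prod_type]
  simp only [← hb', Finset.sum_const, Finset.card_univ, nsmul_eq_mul, Real.negMulLog]
  have : ∑ j, -b j * Real.log (b j) = -∑ j, Real.log (b j) * b j := by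
    rw [← Finset.sum_neg_distrib]
    exact Finset.sum_congr rfl fun _ _ => by ring
  rw [this]
  ring

variable {A B C : Type*} [Fintype A] [Fintype B] [Fintype C] [DecidableEq A] [DecidableEq B]
  [DecidableEq C]

theorem traceFst_traceSnd_prodAssoc (ρ : Matrix (A × B × C) (A × B × C) ℂ) :
    traceFst (traceSnd (ρ.submatrix (Equiv.prodAssoc A B C) (Equiv.prodAssoc A B C))) =
      traceSnd (traceFst ρ) := by
  ext i j
  simp only [traceFst, traceSnd, of_apply, submatrix_apply, Equiv.prodAssoc_apply]
  exact Finset.sum_comm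

/-- Monotonicity under Φ Y = Y ⊗ 1_C, the adjoint of tracing out C, takes the pair (ρ_ABC, 1_A ⊗
ρ_BC) to (ρ_AB, 1_A ⊗ ρ_B). The trace corrections on the two sides are equal and cancel. The
marginals are separate variables so that perturbed spectral decompositions can be supplied for them.
-/
theorem strong_subadditivity_of_pos {ρ : Matrix (A × B × C) (A × B × C) ℂ}
    {ρAB : Matrix (A × B) (A × B) ℂ} {ρBC : Matrix (B × C) (B × C) ℂ} {ρB : Matrix B B ℂ}
    (hAB : ρAB = traceSnd (ρ.submatrix (Equiv.prodAssoc A B C) (Equiv.prodAssoc A B C)))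
    (hBC : ρBC = traceFst ρ) (hB : ρB = traceSnd (traceFst ρ))
    {U : Matrix (A × B × C) I ℂ} {a : I → ℝ} (h : IsSpectralDecomposition ρ U a)
    (ha : ∀ i, 0 < a i)
    {I₁ I₂ I₃ : Type*} [Fintype I₁] [Fintype I₂] [Fintype I₃] [DecidableEq I₁] [DecidableEq I₂]
    [DecidableEq I₃] {U₁ : Matrix (A × B) I₁ ℂ} {a₁ : I₁ → ℝ}
    (h₁ : IsSpectralDecomposition ρAB U₁ a₁) (ha₁ : ∀ i, 0 < a₁ i)
    {U₂ : Matrix (B × C) I₂ ℂ} {a₂ : I₂ → ℝ}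
    (h₂ : IsSpectralDecomposition ρBC U₂ a₂) (ha₂ : ∀ i, 0 < a₂ i)
    {U₃ : Matrix B I₃ ℂ} {a₃ : I₃ → ℝ}
    (h₃ : IsSpectralDecomposition ρB U₃ a₃) (ha₃ : ∀ i, 0 < a₃ i) :
    spectralEntropy ρ + spectralEntropy ρB ≤ spectralEntropy ρAB + spectralEntropy ρBC := by
  have hB' : ρB = traceFst ρAB := by rw [hB, hAB, traceFst_traceSnd_prodAssoc]
  have htr : ρAB.trace = ρ.trace := by
    rw [hAB, trace_traceSnd]
    exact Equiv.sum_comp (Equiv.prodAssoc A B C) fun x => ρ x x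
  have hΦ : ∀ (Y : Matrix (A × B) (A × B) ℂ) (M : Matrix (A × B × C) (A × B × C) ℂ),
      trace ((Y ⊗ₖ (1 : Matrix C C ℂ)).submatrix (Equiv.prodAssoc A B C).symm
        (Equiv.prodAssoc A B C).symm * M) =
      trace (Y * traceSnd (M.submatrix (Equiv.prodAssoc A B C) (Equiv.prodAssoc A B C))) := by
    intro Y M
    rw [← trace_kronecker_one_mul]
    have : M = (M.submatrix (Equiv.prodAssoc A B C) (Equiv.prodAssoc A B C)).submatrix
        (Equiv.prodAssoc A B C).symm (Equiv.prodAssoc A B C).symm := by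
      simp
    conv_lhs => rw [this, submatrix_mul_equiv]
    exact Equiv.sum_comp (Equiv.prodAssoc A B C).symm fun x => ((Y ⊗ₖ (1 : Matrix C C ℂ)) *
      M.submatrix (Equiv.prodAssoc A B C) (Equiv.prodAssoc A B C)) x x
  have key := spectralDivergence_mono h (h₂.one_kronecker (m := A)) ha (fun x => ha₂ x.2)
    h₁ (h₃.one_kronecker (m := A)) ha₁ (fun x => ha₃ x.2)
    (fun Y => (Y ⊗ₖ (1 : Matrix C C ℂ)).submatrix (Equiv.prodAssoc A B C).symm
      (Equiv.prodAssoc A B C).symm)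
    (fun Y => by rw [conjTranspose_submatrix, conjTranspose_kronecker, conjTranspose_one])
    (fun Y Z => by rw [submatrix_mul_equiv, ← mul_kronecker_mul, Matrix.one_mul])
    (fun Y => by rw [hΦ, hAB])
    (fun Y => by
      rw [hΦ]
      congr 2
      ext i j
      simp [hB, hBC, traceSnd, Matrix.one_apply])
  subst hBC
  subst hB'
  rw [spectralDivergence_one_kronecker h ha h₂ ha₂, spectralDivergence_one_kronecker h₁ ha₁ h₃ ha₃,
    htr] at key
  linarith

theorem tendsto_sum_negMulLog_add (b : J → ℝ) {f : ℝ → ℝ} (hf : Continuous f) (hf0 : f 0 = 0) :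
    Filter.Tendsto (fun ε => ∑ i, Real.negMulLog (b i + f ε)) (nhdsWithin 0 (Set.Ioi 0))
      (nhds (∑ i, Real.negMulLog (b i))) := by
  have hc : Continuous fun ε => ∑ i, Real.negMulLog (b i + f ε) :=
    continuous_finsetSum _ fun i _ => Real.continuous_negMulLog.comp (continuous_const.add hf)
  have := hc.tendsto 0
  simp only [hf0, add_zero] at this
  exact this.mono_left nhdsWithin_le_nhds

/-- Strong subadditivity of the von Neumann entropy. -/
theorem strong_subadditivity [Nonempty A] [Nonempty C] {ρ : Matrix (A × B × C) (A × B × C) ℂ}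
    (hρ : ρ.PosSemidef) :
    spectralEntropy ρ + spectralEntropy (traceSnd (traceFst ρ)) ≤
      spectralEntropy (traceSnd (ρ.submatrix (Equiv.prodAssoc A B C) (Equiv.prodAssoc A B C))) +
        spectralEntropy (traceFst ρ) := by
  obtain ⟨U, a, h, ha⟩ := exists_isSpectralDecomposition hρ
  obtain ⟨U₁, a₁, h₁, ha₁⟩ := exists_isSpectralDecomposition
    (traceSnd_posSemidef (hρ.submatrix (Equiv.prodAssoc A B C)))
  obtain ⟨U₂, a₂, h₂, ha₂⟩ := exists_isSpectralDecomposition (traceFst_posSemidef hρ)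
  obtain ⟨U₃, a₃, h₃, ha₃⟩ := exists_isSpectralDecomposition
    (traceSnd_posSemidef (traceFst_posSemidef hρ))
  have hA : (0 : ℝ) < Fintype.card A := by exact_mod_cast Fintype.card_pos
  have hC : (0 : ℝ) < Fintype.card C := by exact_mod_cast Fintype.card_pos
  -- Regularize to the positive definite ρ + ε · 1; each marginal is then shifted by ε times the
  -- dimension traced out, a positive amount as A and C are nonempty. Continuity of -x log x, also
  -- at 0, lets ε tend to 0.
  have key : ∀ ε : ℝ, 0 < ε →
      ∑ i, Real.negMulLog (a i + ε) +
        ∑ i, Real.negMulLog (a₃ i + ε * Fintype.card A * Fintype.card C) ≤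
      ∑ i, Real.negMulLog (a₁ i + ε * Fintype.card C) +
        ∑ i, Real.negMulLog (a₂ i + ε * Fintype.card A) := by
    intro ε hε
    have g := h.add_smul_one ε
    have g₁ := h₁.add_smul_one (ε * Fintype.card C)
    have g₂ := h₂.add_smul_one (ε * Fintype.card A)
    have g₃ := h₃.add_smul_one (ε * Fintype.card A * Fintype.card C)
    rw [← g.spectralEntropy_eq, ← g₁.spectralEntropy_eq, ← g₂.spectralEntropy_eq,
      ← g₃.spectralEntropy_eq]
    refine strong_subadditivity_of_pos ?_ ?_ ?_ g (fun i => add_pos_of_nonneg_of_pos (ha i) hε)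
      g₁ (fun i => add_pos_of_nonneg_of_pos (ha₁ i) (by positivity))
      g₂ (fun i => add_pos_of_nonneg_of_pos (ha₂ i) (by positivity))
      g₃ (fun i => add_pos_of_nonneg_of_pos (ha₃ i) (by positivity))
    · rw [← traceSnd_add_smul_one]
      congr 1
      ext i j
      simp [Matrix.one_apply, Prod.ext_iff, and_assoc]
    · rw [traceFst_add_smul_one]
    · rw [traceFst_add_smul_one, traceSnd_add_smul_one]
  rw [h.spectralEntropy_eq, h₁.spectralEntropy_eq, h₂.spectralEntropy_eq, h₃.spectralEntropy_eq]
  refine le_of_tendsto_of_tendsto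
    ((tendsto_sum_negMulLog_add a (f := fun ε => ε) continuous_id rfl).add
      (tendsto_sum_negMulLog_add a₃ (f := fun ε => ε * Fintype.card A * Fintype.card C)
        (by fun_prop) (by simp)))
    ((tendsto_sum_negMulLog_add a₁ (f := fun ε => ε * Fintype.card C)
        (by fun_prop) (by simp)).add
      (tendsto_sum_negMulLog_add a₂ (f := fun ε => ε * Fintype.card A)
        (by fun_prop) (by simp))) ?_
  filter_upwards [self_mem_nhdsWithin] with ε hε
  exact key ε hε

end StrongSubadditivity

end QInfo

namespace QInfo

open Matrix DensityMatrix
open scoped ComplexOrder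

/-! ### Entropy inequalities for amplitudes of pure states -/

section GramEntropy

theorem gramEntropy_congr {X Y X' Y' : Type*} [Fintype X] [Fintype Y] [Fintype X'] [Fintype Y']
    [DecidableEq X] [DecidableEq X'] {F : Matrix X Y ℂ} {G : Matrix X' Y' ℂ}
    (e : X ≃ X') (f : Y ≃ Y') (h : ∀ x y, F x y = G (e x) (f y)) :
    gramEntropy F = gramEntropy G := by
  rw [← gramEntropy_submatrix G e f]
  congr 1
  ext x y
  exact h x y

theorem gramEntropy_congr_swap {X Y X' Y' : Type*} [Fintype X] [Fintype Y] [Fintype X']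
    [Fintype Y'] [DecidableEq X] [DecidableEq X'] [DecidableEq Y'] {F : Matrix X Y ℂ}
    {G : Matrix X' Y' ℂ} (e : X ≃ Y') (f : Y ≃ X') (h : ∀ x y, F x y = G (f y) (e x)) :
    gramEntropy F = gramEntropy G := by
  rw [← gramEntropy_transpose G]
  exact gramEntropy_congr e f h

variable {A B C K L R : Type*} [Fintype A] [Fintype B] [Fintype C] [Fintype K] [Fintype L]
  [Fintype R] [DecidableEq A] [DecidableEq B] [DecidableEq C] [DecidableEq K] [DecidableEq L]

/-- Strong subadditivity in terms of the amplitudes of a purification. -/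
theorem gramEntropy_strong_subadditivity [Nonempty A] [Nonempty C] (f : A → B → C → R → ℂ) :
    gramEntropy (of fun (x : A × B × C) r => f x.1 x.2.1 x.2.2 r) +
      gramEntropy (of fun b (y : C × A × R) => f y.2.1 b y.1 y.2.2) ≤
    gramEntropy (of fun (x : A × B) (y : C × R) => f x.1 x.2 y.1 y.2) +
      gramEntropy (of fun (x : B × C) (y : A × R) => f y.1 x.1 x.2 y.2) := by
  set M := of fun (x : A × B × C) r => f x.1 x.2.1 x.2.2 r with hM
  have key := strong_subadditivity (posSemidef_self_mul_conjTranspose M)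
  have h1 : traceFst (M * Mᴴ) = (of fun (x : B × C) (y : A × R) => f y.1 x.1 x.2 y.2) *
      (of fun (x : B × C) (y : A × R) => f y.1 x.1 x.2 y.2)ᴴ := by
    ext i j
    simp [traceFst, Matrix.mul_apply, Fintype.sum_prod_type, hM]
  have h2 : traceSnd (traceFst (M * Mᴴ)) = (of fun b (y : C × A × R) => f y.2.1 b y.1 y.2.2) *
      (of fun b (y : C × A × R) => f y.2.1 b y.1 y.2.2)ᴴ := by
    ext i j
    simp [traceFst, traceSnd, Matrix.mul_apply, Fintype.sum_prod_type, hM]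
  have h3 : traceSnd ((M * Mᴴ).submatrix (Equiv.prodAssoc A B C) (Equiv.prodAssoc A B C)) =
      (of fun (x : A × B) (y : C × R) => f x.1 x.2 y.1 y.2) *
      (of fun (x : A × B) (y : C × R) => f x.1 x.2 y.1 y.2)ᴴ := by
    ext i j
    simp [traceSnd, Matrix.mul_apply, Fintype.sum_prod_type, hM]
  rw [h2, h1, h3] at key
  exact key

/-- `I(A : B) + I(A : C) ≤ 2 S(A K)` for a pure state on `A K B C L`. -/
theorem mutualInformation_add_le [Nonempty A] [Nonempty B] [Nonempty C] [Nonempty K] [Nonempty L]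
    (f : A → K → B → C → L → ℂ) :
    2 * gramEntropy (of fun a (y : B × C × K × L) => f a y.2.2.1 y.1 y.2.1 y.2.2.2) +
      gramEntropy (of fun b (y : A × C × K × L) => f y.1 y.2.2.1 b y.2.1 y.2.2.2) +
      gramEntropy (of fun c (y : A × B × K × L) => f y.1 y.2.2.1 y.2.1 c y.2.2.2) -
      gramEntropy (of fun (x : A × B) (y : C × K × L) => f x.1 y.2.1 x.2 y.1 y.2.2) -
      gramEntropy (of fun (x : A × C) (y : B × K × L) => f x.1 y.2.1 y.1 x.2 y.2.2) ≤
    2 * gramEntropy (of fun (x : A × K) (y : (B × C) × L) => f x.1 x.2 y.1.1 y.1.2 y.2) := by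
  -- The three instances are S(KAB) + S(A) ≤ S(KA) + S(AB), the same with C for B, and S(AKCL) +
  -- S(C) ≤ S(AKC) + S(CL). By purity S(AKCL) = S(B) and S(CL) = S(KAB), so in the sum the
  -- three-party terms cancel. The equalities below only match up the orderings of factors and
  -- complementary systems.
  have s1 := gramEntropy_strong_subadditivity (A := K) (B := A) (C := B) (R := C × L)
    (fun k a b y => f a k b y.1 y.2)
  have s2 := gramEntropy_strong_subadditivity (A := K) (B := A) (C := C) (R := B × L)
    (fun k a c y => f a k y.1 c y.2)
  have s3 := gramEntropy_strong_subadditivity (A := A × K) (B := C) (C := L) (R := B)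
    (fun x c l b => f x.1 x.2 b c l)
  have a1 : gramEntropy (of fun b (y : B × K × C × L) => f b y.2.1 y.1 y.2.2.1 y.2.2.2) =
      gramEntropy (of fun a (y : B × C × K × L) => f a y.2.2.1 y.1 y.2.1 y.2.2.2) :=
    gramEntropy_congr (Equiv.refl _) ⟨fun y => (y.1, y.2.2.1, y.2.1, y.2.2.2),
      fun y => (y.1, y.2.2.1, y.2.1, y.2.2.2), fun _ => rfl, fun _ => rfl⟩ fun _ _ => rfl
  have a2 : gramEntropy (of fun b (y : C × K × B × L) => f b y.2.1 y.2.2.1 y.1 y.2.2.2) =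
      gramEntropy (of fun a (y : B × C × K × L) => f a y.2.2.1 y.1 y.2.1 y.2.2.2) :=
    gramEntropy_congr (Equiv.refl _) ⟨fun y => (y.2.2.1, y.1, y.2.1, y.2.2.2),
      fun y => (y.2.1, y.2.2.1, y.1, y.2.2.2), fun _ => rfl, fun _ => rfl⟩ fun _ _ => rfl
  have a3 : gramEntropy (of fun b (y : L × (A × K) × B) => f y.2.1.1 y.2.1.2 y.2.2 b y.1) =
      gramEntropy (of fun c (y : A × B × K × L) => f y.1 y.2.2.1 y.2.1 c y.2.2.2) :=
    gramEntropy_congr (Equiv.refl _) ⟨fun y => (y.2.1.1, y.2.2, y.2.1.2, y.1),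
      fun y => (y.2.2.2, (y.1, y.2.2.1), y.2.1), fun _ => rfl, fun _ => rfl⟩ fun _ _ => rfl
  have a4 : gramEntropy (of fun (x : (A × K) × C × L) b => f x.1.1 x.1.2 b x.2.1 x.2.2) =
      gramEntropy (of fun b (y : A × C × K × L) => f y.1 y.2.2.1 b y.2.1 y.2.2.2) :=
    gramEntropy_congr_swap ⟨fun x => (x.1.1, x.2.1, x.1.2, x.2.2),
      fun y => ((y.1, y.2.2.1), y.2.1, y.2.2.2), fun _ => rfl, fun _ => rfl⟩ (Equiv.refl _)
      fun _ _ => rfl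
  have b1 : gramEntropy (of fun (x : K × A) (y : B × C × L) => f x.2 x.1 y.1 y.2.1 y.2.2) =
      gramEntropy (of fun (x : A × K) (y : (B × C) × L) => f x.1 x.2 y.1.1 y.1.2 y.2) :=
    gramEntropy_congr (Equiv.prodComm _ _) (Equiv.prodAssoc _ _ _).symm fun _ _ => rfl
  have b2 : gramEntropy (of fun (x : K × A) (y : C × B × L) => f x.2 x.1 y.2.1 y.1 y.2.2) =
      gramEntropy (of fun (x : A × K) (y : (B × C) × L) => f x.1 x.2 y.1.1 y.1.2 y.2) :=
    gramEntropy_congr (Equiv.prodComm _ _) ⟨fun y => ((y.2.1, y.1), y.2.2),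
      fun y => (y.1.2, y.1.1, y.2), fun _ => rfl, fun _ => rfl⟩ fun _ _ => rfl
  have c1 : gramEntropy (of fun (x : A × B) (y : K × C × L) => f x.1 y.1 x.2 y.2.1 y.2.2) =
      gramEntropy (of fun (x : A × B) (y : C × K × L) => f x.1 y.2.1 x.2 y.1 y.2.2) :=
    gramEntropy_congr (Equiv.refl _) secondFirst fun _ _ => rfl
  have c2 : gramEntropy (of fun (x : A × C) (y : K × B × L) => f x.1 y.1 y.2.1 x.2 y.2.2) =
      gramEntropy (of fun (x : A × C) (y : B × K × L) => f x.1 y.2.1 y.1 x.2 y.2.2) :=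
    gramEntropy_congr (Equiv.refl _) secondFirst fun _ _ => rfl
  have d1 : gramEntropy (of fun (x : K × A × B) (y : C × L) => f x.2.1 x.1 x.2.2 y.1 y.2) =
      gramEntropy (of fun (x : C × L) (y : (A × K) × B) => f y.1.1 y.1.2 y.2 x.1 x.2) :=
    gramEntropy_congr_swap ⟨fun x => ((x.2.1, x.1), x.2.2), fun y => (y.1.2, y.1.1, y.2),
      fun _ => rfl, fun _ => rfl⟩ (Equiv.refl _) fun _ _ => rfl
  have d2 : gramEntropy (of fun (x : K × A × C) (y : B × L) => f x.2.1 x.1 y.1 x.2.2 y.2) =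
      gramEntropy (of fun (x : (A × K) × C) (y : L × B) => f x.1.1 x.1.2 y.2 x.2 y.1) :=
    gramEntropy_congr ⟨fun x => ((x.2.1, x.1), x.2.2), fun y => (y.1.2, y.1.1, y.2),
      fun _ => rfl, fun _ => rfl⟩ (Equiv.prodComm _ _) fun _ _ => rfl
  linarith

end GramEntropy

/-! ### Entropies of marginals as entropies of amplitude matrices -/

section Marginals

variable {ι κ μ τ : Type*} [Fintype ι] [Fintype κ] [Fintype μ] [Fintype τ] [DecidableEq κ]

/-- G is a purification of ρ with environment τ; tracing out μ merely enlarges the environment to μ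
× τ. -/
theorem DensityMatrix.entropy_marginal_of_factor {ρ : DensityMatrix ι} {G : ι → τ → ℂ}
    (h : ∀ i j, ρ.mat i j = ∑ t, G i t * star (G j t)) (e : ι ≃ κ × μ) :
    (ρ.marginal e).entropy = gramEntropy (of fun x (y : μ × τ) => G (e.symm (x, y.1)) y.2) := by
  rw [entropy_eq_spectralEntropy, gramEntropy]
  congr 1
  ext i j
  simp [marginal, DensityMatrix.reindex, traceRight, h, Matrix.mul_apply, Fintype.sum_prod_type]

theorem DensityMatrix.entropy_marginal_pureState (ψ : EuclideanSpace ℂ ι) (hψ : ‖ψ‖ = 1)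
    (e : ι ≃ κ × μ) :
    ((pureState ψ hψ).marginal e).entropy = gramEntropy (of fun x y => ψ (e.symm (x, y))) := by
  rw [entropy_eq_spectralEntropy, gramEntropy]
  congr 1

theorem exists_apply_ne_zero_of_norm_eq_one {ψ : EuclideanSpace ℂ ι} (hψ : ‖ψ‖ = 1) :
    ∃ i, ψ i ≠ 0 := by
  by_contra! h
  have : ψ = 0 := by
    ext i
    exact h i
  simp [this] at hψ

end Marginals

/-! ### Bounds on the entanglement of purification for arbitrary states -/

section Bounds

variable {A B C K L : Type*} [Fintype A] [Fintype B] [Fintype C] [Fintype K] [Fintype L]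
  [DecidableEq A] [DecidableEq B] [DecidableEq C] [DecidableEq K] [DecidableEq L]

/-- `A B C ≃ (A C) B`. -/
def firstThird : A × B × C ≃ (A × C) × B where
  toFun x := ((x.1, x.2.2), x.2.1)
  invFun x := (x.1.1, x.2, x.1.2)
  left_inv _ := rfl
  right_inv _ := rfl

/-- `E_p(A : BC) ≥ I(A : B) + I(A : C)`. -/
theorem mutualInformation_add_le_eop₂ (ρ : DensityMatrix (A × B × C)) :
    2 * (ρ.marginal (Equiv.refl _)).entropy + (ρ.marginal secondFirst).entropy
      + (ρ.marginal thirdFirst).entropy - (ρ.marginal (Equiv.prodAssoc A B C).symm).entropy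
      - (ρ.marginal firstThird).entropy ≤ eop₂ ρ := by
  refine le_csInf (nonempty_purificationValues₂ ρ) ?_
  rintro s ⟨k, l, ψ, hψ, hρ, rfl⟩
  -- A nonzero amplitude of the unit vector supplies a basis label in every factor, hence the
  -- nonemptiness that strong subadditivity needs.
  obtain ⟨⟨⟨a, x⟩, ⟨b, c⟩, y⟩, -⟩ := exists_apply_ne_zero_of_norm_eq_one hψ
  have : Nonempty A := ⟨a⟩
  have : Nonempty B := ⟨b⟩
  have : Nonempty C := ⟨c⟩
  have : Nonempty (Fin k) := ⟨x⟩
  have : Nonempty (Fin l) := ⟨y⟩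
  have h : ∀ i j, ρ.mat i j = ∑ t : Fin k × Fin l, ψ ((i.1, t.1), (i.2, t.2)) *
      star (ψ ((j.1, t.1), (j.2, t.2))) := by
    intro i j
    rw [← hρ]
    simp [marginal, DensityMatrix.reindex, traceRight, pureState, vecMulVec_apply, regroup₂]
  have key := mutualInformation_add_le fun a (x : Fin k) b c (y : Fin l) => ψ ((a, x), ((b, c), y))
  rw [entropy_marginal_of_factor h, entropy_marginal_of_factor h, entropy_marginal_of_factor h,
    entropy_marginal_of_factor h, entropy_marginal_of_factor h, entropy_marginal_pureState,
    entropy_marginal_pureState]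
  have e1 : gramEntropy (of fun x y => ψ ((Equiv.prodComm (A × Fin k) ((B × C) × Fin l)).symm
      (x, y))) = gramEntropy (of fun x y => ψ ((Equiv.refl _).symm (x, y))) :=
    gramEntropy_congr_swap (Equiv.refl _) (Equiv.refl _) fun _ _ => rfl
  rw [e1, ← two_mul]
  refine le_trans (le_of_eq ?_) key
  congr 1
  congr 1
  congr 1
  congr 1
  · congr 1
    exact gramEntropy_congr (Equiv.refl _) (Equiv.prodAssoc _ _ _) fun _ _ => rfl
  · exact gramEntropy_congr (Equiv.refl _) (Equiv.prodAssoc _ _ _) fun _ _ => rfl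
  · exact gramEntropy_congr (Equiv.refl _) (Equiv.prodAssoc _ _ _) fun _ _ => rfl

/-- Both sides of the purification f have the same entropy, whence the factor 2. Arbitrary finite
types K and L are allowed so that product auxiliaries such as B̃C̃ can be used directly. -/
theorem eop₂_le_of_purification (ρ : DensityMatrix (A × B)) (f : Matrix (A × K) (B × L) ℂ)
    (h : ∀ i j, ρ.mat i j = ∑ t : K × L, f (i.1, t.1) (i.2, t.2) *
      star (f (j.1, t.1) (j.2, t.2))) :
    eop₂ ρ ≤ 2 * gramEntropy f := by
  let eK := Fintype.equivFin K
  let eL := Fintype.equivFin L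
  let ψ : EuclideanSpace ℂ ((A × Fin (Fintype.card K)) × (B × Fin (Fintype.card L))) :=
    WithLp.toLp 2 fun x => f (x.1.1, eK.symm x.1.2) (x.2.1, eL.symm x.2.2)
  have hψ : ‖ψ‖ = 1 := by
    apply norm_eq_one_of_sum
    rw [← sum_factor h, ← regroup₂.symm.sum_comp, Fintype.sum_prod_type]
    refine Finset.sum_congr rfl fun i _ => ?_
    exact Equiv.sum_comp (eK.symm.prodCongr eL.symm)
      fun t => ‖f (i.1, t.1) (i.2, t.2)‖ ^ 2
  refine (csInf_le (bddBelow_purificationValues₂ ρ) ⟨_, _, ψ, hψ, ?_, rfl⟩).trans_eq ?_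
  · apply DensityMatrix.ext'
    ext i j
    rw [h]
    simp only [marginal, DensityMatrix.reindex, traceRight, pureState, vecMulVec_apply, of_apply,
      submatrix_apply, Pi.star_apply]
    exact Equiv.sum_comp (eK.symm.prodCongr eL.symm)
      fun t => f (i.1, t.1) (i.2, t.2) * star (f (j.1, t.1) (j.2, t.2))
  · rw [entropy_marginal_pureState, entropy_marginal_pureState, two_mul]
    congr 1
    · exact gramEntropy_congr ((Equiv.refl _).prodCongr eK.symm)
        ((Equiv.refl _).prodCongr eL.symm) fun _ _ => rfl
    · exact gramEntropy_congr_swap ((Equiv.refl _).prodCongr eL.symm)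
        ((Equiv.refl _).prodCongr eK.symm) fun _ _ => rfl

/-- `E_p(A : B : C) ≤ S(BC) + S(B) + S(C)`. -/
theorem eop₃_le (ρ : DensityMatrix (A × B × C)) :
    eop₃ ρ ≤ (ρ.marginal (Equiv.prodComm _ _)).entropy + (ρ.marginal secondFirst).entropy
      + (ρ.marginal thirdFirst).entropy := by
  obtain ⟨m, F, hF⟩ := ρ.exists_factor
  -- The whole purifying system is given to Ã, while B̃ and C̃ are one-dimensional; then S(AÃ) =
  -- S(BC) by purity.
  let ψ : EuclideanSpace ℂ ((A × Fin m) × (B × Fin 1) × (C × Fin 1)) :=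
    WithLp.toLp 2 fun x => F (x.1.1, x.2.1.1, x.2.2.1) x.1.2
  have hψ : ‖ψ‖ = 1 := by
    apply norm_eq_one_of_sum
    rw [← sum_factor hF, ← (regroup₃ (A := A) (B := B) (C := C)).symm.sum_comp]
    simp [ψ, Fintype.sum_prod_type, regroup₃]
  refine (csInf_le (bddBelow_purificationValues₃ ρ) ⟨_, 1, 1, ψ, hψ, ?_, rfl⟩).trans_eq ?_
  · apply DensityMatrix.ext'
    ext i j
    rw [hF]
    simp [marginal, DensityMatrix.reindex, traceRight, pureState, ψ, Fintype.sum_prod_type, regroup₃,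
      vecMulVec_apply]
  · simp only [entropy_marginal_pureState, entropy_marginal_of_factor hF]
    congr 1
    congr 1
    · exact gramEntropy_congr_swap (Equiv.refl _)
        ((Equiv.prodUnique _ _).prodCongr (Equiv.prodUnique _ _)) fun _ _ => rfl
    · exact gramEntropy_congr (Equiv.prodUnique _ _)
        ⟨fun y => ((y.1.1, y.2.1), y.1.2), fun y => ((y.1.1, y.2), y.1.2, 0),
          fun y => by ext <;> simp, fun _ => rfl⟩ fun _ _ => rfl
    · exact gramEntropy_congr (Equiv.prodUnique _ _)
        ⟨fun y => ((y.1.1, y.2.1), y.1.2), fun y => ((y.1.1, y.2), y.1.2, 0),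
          fun y => by ext <;> simp, fun _ => rfl⟩ fun _ _ => rfl

/-- Every tripartite purification is a trial purification for each of the three bipartite cuts,
where its value is twice the entropy of the singled-out party with its auxiliary. -/
theorem signal₃_nonneg (ρ : DensityMatrix (A × B × C)) : 0 ≤ signal₃ ρ := by
  rw [signal₃, sub_nonneg]
  refine le_csInf (nonempty_purificationValues₃ ρ) ?_
  rintro s ⟨k, l, m, ψ, hψ, hρ, rfl⟩
  have h : ∀ i j, ρ.mat i j = ∑ t : Fin k × Fin l × Fin m,
      ψ ((i.1, t.1), (i.2.1, t.2.1), (i.2.2, t.2.2)) *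
      star (ψ ((j.1, t.1), (j.2.1, t.2.1), (j.2.2, t.2.2))) := by
    intro i j
    rw [← hρ]
    simp [marginal, DensityMatrix.reindex, traceRight, pureState, vecMulVec_apply, regroup₃]
  have h1 := eop₂_le_of_purification ρ (of fun (x : A × Fin k) (y : (B × C) × (Fin l × Fin m)) =>
    ψ (x, (y.1.1, y.2.1), (y.1.2, y.2.2))) fun i j => h i j
  have h2 := eop₂_le_of_purification (ρ.reindex secondFirst)
    (of fun (x : B × Fin l) (y : (A × C) × (Fin k × Fin m)) =>
      ψ ((y.1.1, y.2.1), x, (y.1.2, y.2.2))) fun i j =>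
        (h _ _).trans (Equiv.sum_comp secondFirst.symm _).symm
  have h3 := eop₂_le_of_purification (ρ.reindex thirdFirst)
    (of fun (x : C × Fin m) (y : (A × B) × (Fin k × Fin l)) =>
      ψ ((y.1.1, y.2.1), (y.1.2, y.2.2), x)) fun i j =>
        (h _ _).trans (Equiv.sum_comp thirdFirst.symm _).symm
  simp only [entropy_marginal_pureState]
  have e1 : gramEntropy (of fun (x : A × Fin k) (y : (B × C) × (Fin l × Fin m)) =>
      ψ (x, (y.1.1, y.2.1), (y.1.2, y.2.2))) =
      gramEntropy (of fun x y => ψ ((Equiv.refl _).symm (x, y))) :=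
    gramEntropy_congr (Equiv.refl _) regroup₂.symm fun _ _ => rfl
  have e2 : gramEntropy (of fun (x : B × Fin l) (y : (A × C) × (Fin k × Fin m)) =>
      ψ ((y.1.1, y.2.1), x, (y.1.2, y.2.2))) =
      gramEntropy (of fun x y => ψ (secondFirst.symm (x, y))) :=
    gramEntropy_congr (Equiv.refl _) regroup₂.symm fun _ _ => rfl
  have e3 : gramEntropy (of fun (x : C × Fin m) (y : (A × B) × (Fin k × Fin l)) =>
      ψ ((y.1.1, y.2.1), (y.1.2, y.2.2), x)) =
      gramEntropy (of fun x y => ψ (thirdFirst.symm (x, y))) :=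
    gramEntropy_congr (Equiv.refl _) regroup₂.symm fun _ _ => rfl
  linarith

end Bounds

end QInfo

namespace QInfo

open Matrix DensityMatrix

/-! ### Schmidt decomposition of W-type amplitudes -/

section Weights

/-- `w` takes the value `0` exactly once and the value `1` exactly `p` times. -/
structure HasWeights {X : Type*} [Fintype X] (w : X → ℕ) (p : ℕ) : Prop where
  card_zero : (Finset.univ.filter fun x => w x = 0).card = 1
  card_one : (Finset.univ.filter fun x => w x = 1).card = p

variable {X Y : Type*} [Fintype X] [Fintype Y]

theorem HasWeights.add {v : X → ℕ} {w : Y → ℕ} {p q : ℕ} (hv : HasWeights v p)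
    (hw : HasWeights w q) : HasWeights (fun z : X × Y => v z.1 + w z.2) (p + q) := by
  classical
  constructor
  · have : (Finset.univ.filter fun z : X × Y => v z.1 + w z.2 = 0) =
        (Finset.univ.filter fun x => v x = 0) ×ˢ (Finset.univ.filter fun y => w y = 0) := by
      ext z
      simp
    rw [this, Finset.card_product, hv.card_zero, hw.card_zero]
  · have : (Finset.univ.filter fun z : X × Y => v z.1 + w z.2 = 1) =
        (Finset.univ.filter fun x => v x = 1) ×ˢ (Finset.univ.filter fun y => w y = 0) ∪
        (Finset.univ.filter fun x => v x = 0) ×ˢ (Finset.univ.filter fun y => w y = 1) := by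
      ext z
      simp only [Finset.mem_filter, Finset.mem_univ, true_and, Finset.mem_union,
        Finset.mem_product]
      omega
    rw [this, Finset.card_union_of_disjoint, Finset.card_product, Finset.card_product,
      hv.card_zero, hw.card_zero, hv.card_one, hw.card_one]
    · ring
    · rw [Finset.disjoint_left]
      intro z
      simp only [Finset.mem_filter, Finset.mem_univ, true_and, Finset.mem_product]
      omega

/-- The amplitude of a bit string of Hamming weight `k` in the `W` state of `n` qubits. -/
noncomputable def wAmplitude (n k : ℕ) : ℂ := if k = 1 then ((1 / Real.sqrt n : ℝ) : ℂ) else 0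

theorem gramEntropy_wAmplitude [DecidableEq X] {v : X → ℕ} {w : Y → ℕ} {n p q : ℕ}
    (hv : HasWeights v p) (hw : HasWeights w q) :
    gramEntropy (of fun x y => wAmplitude n (v x + w y)) =
      Real.negMulLog ((p : ℝ) / n) + Real.negMulLog ((q : ℝ) / n) := by
  -- Amplitudes vanish unless the total weight is 1, so only weights 0 and 1 on X matter: P records
  -- that weight and Q holds the matching amplitudes. The nonzero spectrum of P Q Qᴴ Pᴴ is then that
  -- of the 2 × 2 matrix Q Qᴴ Pᴴ P, which is diagonal with entries q / n and p / n.
  let P : Matrix X (Fin 2) ℂ := of fun x s => if v x = s then 1 else 0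
  let Q : Matrix (Fin 2) Y ℂ := of fun s y => if w y + s = 1 then ((1 / Real.sqrt n : ℝ) : ℂ) else 0
  have hF : (of fun x y => wAmplitude n (v x + w y)) = P * Q := by
    ext x y
    simp only [P, Q, of_apply, Matrix.mul_apply, Fin.sum_univ_two, wAmplitude, Fin.val_zero,
      Fin.val_one]
    rcases Nat.lt_or_ge (v x) 2 with h | h
    · interval_cases h' : v x
      · simp
      · simp [add_comm]
    · have h0 : v x ≠ 0 := by omega
      have h1 : v x ≠ 1 := by omega
      have h2 : v x + w y ≠ 1 := by omega
      simp [h0, h1, h2]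
  have hc : (((Real.sqrt n : ℝ) : ℂ)⁻¹) * ((Real.sqrt n : ℝ) : ℂ)⁻¹ = (n : ℂ)⁻¹ := by
    rw [← mul_inv, ← Complex.ofReal_mul, Real.mul_self_sqrt (Nat.cast_nonneg n),
      Complex.ofReal_natCast]
  have hP : Pᴴ * P = diagonal ![(1 : ℂ), p] := by
    ext s t
    fin_cases s <;> fin_cases t
    · simp [P, Matrix.mul_apply, apply_ite (starRingEnd ℂ), Finset.sum_ite, Finset.filter_filter,
        hv.card_zero]
    · simp only [Matrix.mul_apply, P, conjTranspose_apply, of_apply]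
      refine (Finset.sum_eq_zero fun x _ => ?_).trans (by simp)
      by_cases h : v x = 0 <;> simp [h]
    · simp only [Matrix.mul_apply, P, conjTranspose_apply, of_apply]
      refine (Finset.sum_eq_zero fun x _ => ?_).trans (by simp)
      by_cases h : v x = 0 <;> simp [h]
    · simp [P, Matrix.mul_apply, apply_ite (starRingEnd ℂ), Finset.sum_ite, Finset.filter_filter,
        hv.card_one]
  have hQ : Q * Qᴴ = diagonal ![(q : ℂ) / n, 1 / n] := by
    ext s t
    fin_cases s <;> fin_cases t
    · simp [Q, Matrix.mul_apply, apply_ite (starRingEnd ℂ), hw.card_one, hc, Finset.sum_ite,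
        Finset.filter_filter, div_eq_mul_inv]
    · simp only [Matrix.mul_apply, Q, conjTranspose_apply, of_apply]
      refine (Finset.sum_eq_zero fun x _ => ?_).trans (by simp)
      by_cases h : w x = 0 <;> simp [h]
    · simp only [Matrix.mul_apply, Q, conjTranspose_apply, of_apply]
      refine (Finset.sum_eq_zero fun x _ => ?_).trans (by simp)
      by_cases h : w x = 0 <;> simp [h]
    · simp [Q, Matrix.mul_apply, apply_ite (starRingEnd ℂ), hw.card_zero, hc, Finset.sum_ite,
        Finset.filter_filter]
  have hD : Q * Qᴴ * (Pᴴ * P) =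
      diagonal fun s => ((![(q : ℝ) / n, (p : ℝ) / n] s : ℝ) : ℂ) := by
    rw [hP, hQ, diagonal_mul_diagonal]
    congr 1
    funext s
    fin_cases s <;> simp [div_eq_mul_inv, mul_comm]
  rw [gramEntropy, hF, conjTranspose_mul, Matrix.mul_assoc, spectralEntropy_mul_comm,
    ← Matrix.mul_assoc, Matrix.mul_assoc, hD, spectralEntropy_diagonal, Fin.sum_univ_two]
  exact add_comm _ _

end Weights

/-! ### Hamming weights of bit strings -/

section HammingWeight

variable {P : Type*} [Fintype P]

/-- The Hamming weight of a bit string. -/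
def hammingWeight (x : P → Fin 2) : ℕ := ∑ i, (x i : ℕ)

theorem hammingWeight_eq_zero_iff {x : P → Fin 2} : hammingWeight x = 0 ↔ x = 0 := by
  simp [hammingWeight, funext_iff]

theorem hammingWeight_eq_one_iff [DecidableEq P] {x : P → Fin 2} :
    hammingWeight x = 1 ↔ ∃ i, Pi.single i 1 = x := by
  constructor
  · intro h
    obtain ⟨i, hi⟩ : ∃ i, x i ≠ 0 := by
      by_contra! h0
      rw [hammingWeight_eq_zero_iff.mpr (funext h0)] at h
      exact zero_ne_one h
    have hsplit := Finset.add_sum_erase Finset.univ (fun j => (x j : ℕ)) (Finset.mem_univ i)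
    have hi1 : (x i : ℕ) = 1 := by
      have := Fin.val_ne_of_ne hi
      have := (x i).isLt
      simp at *
      omega
    have hrest : ∑ j ∈ Finset.univ.erase i, (x j : ℕ) = 0 := by
      rw [hammingWeight] at h
      omega
    refine ⟨i, funext fun j => ?_⟩
    rcases eq_or_ne j i with rfl | hj
    · rw [Pi.single_eq_same]
      exact (Fin.ext hi1).symm
    · rw [Pi.single_eq_of_ne hj]
      have := (Finset.sum_eq_zero_iff.mp hrest) j (by simp [hj])
      exact (Fin.ext this).symm
  · rintro ⟨i, rfl⟩
    rw [hammingWeight, Finset.sum_eq_single i]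
    · simp
    · intro j _ hj
      simp [Pi.single_eq_of_ne hj]
    · simp

omit [Fintype P] in
theorem single_one_injective [DecidableEq P] :
    Function.Injective fun i : P => (Pi.single i 1 : P → Fin 2) := by
  intro i j h
  by_contra hij
  have := congrFun h i
  simp [Pi.single_eq_of_ne hij] at this

theorem hasWeights_hammingWeight [DecidableEq P] :
    HasWeights (hammingWeight : (P → Fin 2) → ℕ) (Fintype.card P) := by
  constructor
  · rw [Finset.card_eq_one]
    exact ⟨0, by ext; simp [hammingWeight_eq_zero_iff]⟩
  · have : (Finset.univ.filter fun x : P → Fin 2 => hammingWeight x = 1) =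
        Finset.univ.image fun i : P => (Pi.single i 1 : P → Fin 2) := by
      ext x
      simp [hammingWeight_eq_one_iff]
    rw [this, Finset.card_image_of_injective _ single_one_injective, Finset.card_univ]

theorem wVector_apply {n : ℕ} (x : Fin n → Fin 2) :
    wVector n x = wAmplitude n (hammingWeight x) := by
  have h : wVector n x = ((1 / Real.sqrt n : ℝ) : ℂ) *
      ∑ i : Fin n, if x = Pi.single i 1 then (1 : ℂ) else 0 := by
    simp [wVector, Pi.single_apply]
  rw [h, wAmplitude]
  split_ifs with hx
  · obtain ⟨i, rfl⟩ := hammingWeight_eq_one_iff.mp hx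
    rw [Finset.sum_eq_single i]
    · simp
    · intro j _ hj
      rw [if_neg]
      exact fun h => hj (single_one_injective h).symm
    · simp
  · rw [Finset.sum_eq_zero, mul_zero]
    intro i _
    rw [if_neg]
    rintro rfl
    exact hx (hammingWeight_eq_one_iff.mpr ⟨i, rfl⟩)

theorem hammingWeight_piEquivPiSubtypeProd_symm (p : P → Prop) [DecidablePred p]
    [Fintype {i // p i}] [Fintype {i // ¬p i}] (x : {i // p i} → Fin 2) (y : {i // ¬p i} → Fin 2) :
    hammingWeight ((Equiv.piEquivPiSubtypeProd p fun _ => Fin 2).symm (x, y)) =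
      hammingWeight x + hammingWeight y := by
  rw [hammingWeight, ← Fintype.sum_subtype_add_sum_subtype p, hammingWeight, hammingWeight]
  congr 1 <;> refine Finset.sum_congr (by ext; simp) fun i _ => ?_
  · simp [Equiv.piEquivPiSubtypeProd, i.2]
  · simp [Equiv.piEquivPiSubtypeProd, i.2]

omit [Fintype P] in
theorem hammingWeight_piFinsetUnion [DecidableEq P] {s t : Finset P} (h : Disjoint s t)
    (x : s → Fin 2) (y : t → Fin 2) :
    hammingWeight (Equiv.piFinsetUnion (fun _ => Fin 2) h (x, y)) =
      hammingWeight x + hammingWeight y := by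
  rw [hammingWeight, ← (Equiv.Finset.union s t h).sum_comp, Fintype.sum_sum_type, hammingWeight,
    hammingWeight]
  congr 1 <;> refine Finset.sum_congr rfl fun i _ => ?_
  · rw [Equiv.Finset.union_inl, Equiv.piFinsetUnion_left _ h i.2]
  · rw [Equiv.Finset.union_inr, Equiv.piFinsetUnion_right _ h i.2]

end HammingWeight

/-! ### Reduced states of W and the bound on the signal -/

section WState

variable {n : ℕ}

/-- `ρ` is the reduced state of a vector whose amplitudes are those of the `W` state of `n` qubits,
where `w` and `v` are the weights on the system and on its complement. -/
def HasWFactor {ι R : Type*} [Fintype ι] [Fintype R] (n : ℕ) (ρ : DensityMatrix ι) (w : ι → ℕ)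
    (v : R → ℕ) : Prop :=
  ∀ i j, ρ.mat i j = ∑ t, wAmplitude n (w i + v t) * star (wAmplitude n (w j + v t))

theorem HasWFactor.entropy_marginal {ι κ μ R : Type*} [Fintype ι] [Fintype κ] [Fintype μ]
    [Fintype R] [DecidableEq κ] {ρ : DensityMatrix ι} {w : ι → ℕ} {v : R → ℕ}
    (h : HasWFactor n ρ w v) (e : ι ≃ κ × μ) {w₁ : κ → ℕ} {w₂ : μ → ℕ}
    (he : ∀ x y, w (e.symm (x, y)) = w₁ x + w₂ y) {p q r : ℕ} (h₁ : HasWeights w₁ p)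
    (h₂ : HasWeights w₂ q) (hv : HasWeights v r) :
    (ρ.marginal e).entropy =
      Real.negMulLog ((p : ℝ) / n) + Real.negMulLog (((q + r : ℕ) : ℝ) / n) := by
  rw [← gramEntropy_wAmplitude h₁ (h₂.add hv),
    entropy_marginal_of_factor (G := fun i t => wAmplitude n (w i + v t)) h]
  simp only [he, add_assoc]

theorem HasWFactor.reindex {ι κ R : Type*} [Fintype ι] [Fintype κ] [Fintype R]
    {ρ : DensityMatrix ι} {w : ι → ℕ} {v : R → ℕ} (h : HasWFactor n ρ w v) (e : ι ≃ κ) :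
    HasWFactor n (ρ.reindex e) (fun x => w (e.symm x)) v :=
  fun _ _ => h _ _

theorem entropy_reduceTo_wState (hn : 0 < n) (T : Finset (Fin n)) :
    (reduceTo (wState n hn) T).entropy =
      Real.negMulLog ((T.card : ℝ) / n) + Real.negMulLog (((n - T.card : ℕ) : ℝ) / n) := by
  have h1 := hasWeights_hammingWeight (P := T)
  have h2 := hasWeights_hammingWeight (P := {i // i ∉ T})
  rw [Fintype.card_coe] at h1
  rw [Fintype.card_subtype_compl, Fintype.card_fin, Fintype.card_coe] at h2
  rw [← gramEntropy_wAmplitude h1 h2, reduceTo, wState, entropy_marginal_pureState]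
  simp only [wVector_apply, hammingWeight_piEquivPiSubtypeProd_symm]

theorem hasWFactor_reduceTo₃ (hn : 0 < n) (A B C : Finset (Fin n)) (hAB : Disjoint A B)
    (hAC : Disjoint A C) (hBC : Disjoint B C) :
    HasWFactor n (reduceTo₃ (wState n hn) A B C hAB hAC hBC)
      (fun x => hammingWeight x.1 + (hammingWeight x.2.1 + hammingWeight x.2.2))
      (hammingWeight : ({i // i ∉ A ∪ (B ∪ C)} → Fin 2) → ℕ) := by
  have h : HasWFactor n (reduceTo (wState n hn) (A ∪ (B ∪ C))) hammingWeight
      (hammingWeight : ({i // i ∉ A ∪ (B ∪ C)} → Fin 2) → ℕ) := by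
    have hw : ∀ (x : (A ∪ (B ∪ C) : Finset (Fin n)) → Fin 2) (t : {i // i ∉ A ∪ (B ∪ C)} → Fin 2),
        wAmplitude n (hammingWeight x + hammingWeight t) = wVector n
          ((Equiv.piEquivPiSubtypeProd (fun i => i ∈ A ∪ (B ∪ C)) fun _ => Fin 2).symm (x, t)) :=
      fun x t => by rw [wVector_apply, hammingWeight_piEquivPiSubtypeProd_symm]
    intro x y
    simp only [hw]
    rfl
  rintro ⟨a, b, c⟩ ⟨a', b', c'⟩
  refine (h _ _).trans ?_
  simp [hammingWeight_piFinsetUnion]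

variable {A B C R : Type*} [Fintype A] [Fintype B] [Fintype C] [Fintype R]
  [DecidableEq A] [DecidableEq B] [DecidableEq C]

/-- With S₁ and S₂ the one- and two-party entropies, I(A:B) + I(A:C) is 4 S₁ - 2 S₂; the counts 2 +
r and 1 + r belong to the complements of one and of two parties. -/
theorem HasWFactor.le_eop₂ {ρ : DensityMatrix (A × B × C)} {wA : A → ℕ} {wB : B → ℕ} {wC : C → ℕ}
    {v : R → ℕ} {w : A × B × C → ℕ} (h : HasWFactor n ρ w v)
    (hw : ∀ a b c, w (a, b, c) = wA a + wB b + wC c) {r : ℕ}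
    (hA : HasWeights wA 1) (hB : HasWeights wB 1) (hC : HasWeights wC 1) (hv : HasWeights v r) :
    4 * (Real.negMulLog ((1 : ℕ) / n : ℝ) + Real.negMulLog ((2 + r : ℕ) / n : ℝ))
      - 2 * (Real.negMulLog ((2 : ℕ) / n : ℝ) + Real.negMulLog ((1 + r : ℕ) / n : ℝ)) ≤ eop₂ ρ := by
  have key := mutualInformation_add_le_eop₂ ρ
  rw [h.entropy_marginal (Equiv.refl _) (w₁ := wA) (w₂ := fun y => wB y.1 + wC y.2)
      (fun x y => (hw _ _ _).trans (add_assoc _ _ _)) hA (hB.add hC) hv,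
    h.entropy_marginal secondFirst (w₁ := wB) (w₂ := fun y => wA y.1 + wC y.2)
      (fun x y => (hw _ _ _).trans (by ring)) hB (hA.add hC) hv,
    h.entropy_marginal thirdFirst (w₁ := wC) (w₂ := fun y => wA y.1 + wB y.2)
      (fun x y => (hw _ _ _).trans (by ring)) hC (hA.add hB) hv,
    h.entropy_marginal (Equiv.prodAssoc A B C).symm (w₁ := fun y => wA y.1 + wB y.2) (w₂ := wC)
      (fun x y => hw _ _ _) (hA.add hB) hC hv,
    h.entropy_marginal firstThird (w₁ := fun y => wA y.1 + wC y.2) (w₂ := wB)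
      (fun x y => (hw _ _ _).trans (by ring)) (hA.add hC) hB hv] at key
  refine le_trans (le_of_eq ?_) key
  norm_num
  ring

theorem HasWFactor.eop₃_le {ρ : DensityMatrix (A × B × C)} {wA : A → ℕ} {wB : B → ℕ} {wC : C → ℕ}
    {v : R → ℕ} {w : A × B × C → ℕ} (h : HasWFactor n ρ w v)
    (hw : ∀ a b c, w (a, b, c) = wA a + wB b + wC c) {r : ℕ}
    (hA : HasWeights wA 1) (hB : HasWeights wB 1) (hC : HasWeights wC 1) (hv : HasWeights v r) :
    eop₃ ρ ≤ 2 * (Real.negMulLog ((1 : ℕ) / n : ℝ) + Real.negMulLog ((2 + r : ℕ) / n : ℝ))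
      + (Real.negMulLog ((2 : ℕ) / n : ℝ) + Real.negMulLog ((1 + r : ℕ) / n : ℝ)) := by
  have key := QInfo.eop₃_le ρ
  rw [h.entropy_marginal (Equiv.prodComm _ _) (w₁ := fun y => wB y.1 + wC y.2) (w₂ := wA)
      (fun x y => (hw _ _ _).trans (by ring)) (hB.add hC) hA hv,
    h.entropy_marginal secondFirst (w₁ := wB) (w₂ := fun y => wA y.1 + wC y.2)
      (fun x y => (hw _ _ _).trans (by ring)) hB (hA.add hC) hv,
    h.entropy_marginal thirdFirst (w₁ := wC) (w₂ := fun y => wA y.1 + wB y.2)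
      (fun x y => (hw _ _ _).trans (by ring)) hC (hA.add hB) hv] at key
  refine key.trans (le_of_eq ?_)
  norm_num
  ring

/-- The weights are symmetric in the three parties, so `HasWFactor.le_eop₂` applies to all three
cuts after relabelling. -/
theorem HasWFactor.signal₃_le {ρ : DensityMatrix (A × B × C)} {wA : A → ℕ} {wB : B → ℕ}
    {wC : C → ℕ} {v : R → ℕ} {w : A × B × C → ℕ} (h : HasWFactor n ρ w v)
    (hw : ∀ a b c, w (a, b, c) = wA a + wB b + wC c) {r : ℕ}
    (hA : HasWeights wA 1) (hB : HasWeights wB 1) (hC : HasWeights wC 1) (hv : HasWeights v r) :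
    signal₃ ρ ≤ 4 * ((Real.negMulLog ((2 : ℕ) / n : ℝ) + Real.negMulLog ((1 + r : ℕ) / n : ℝ))
      - (Real.negMulLog ((1 : ℕ) / n : ℝ) + Real.negMulLog ((2 + r : ℕ) / n : ℝ))) := by
  have h1 := h.le_eop₂ hw hA hB hC hv
  have h2 := (h.reindex secondFirst).le_eop₂ (wA := wB) (wB := wA) (wC := wC)
    (fun b a c => (hw a b c).trans (by ring)) hB hA hC hv
  have h3 := (h.reindex thirdFirst).le_eop₂ (wA := wC) (wB := wA) (wC := wB)
    (fun c a b => (hw a b c).trans (by ring)) hC hA hB hv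
  have h4 := h.eop₃_le hw hA hB hC hv
  rw [signal₃]
  linarith

end WState

end QInfo

theorem mainTheorem4 (n : ℕ) (hn : 0 < n) :
    (∀ T : Finset (Fin n),
      (QInfo.reduceTo (QInfo.wState n hn) T).entropy =
        -((T.card : ℝ) / n * Real.log ((T.card : ℝ) / n))
          - ((n : ℝ) - T.card) / n * Real.log (((n : ℝ) - T.card) / n)) ∧
    (∀ (A B C : Finset (Fin n)) (hAB : Disjoint A B) (hAC : Disjoint A C) (hBC : Disjoint B C),
      A.card = 1 → B.card = 1 → C.card = 1 →
      0 ≤ QInfo.signal₃ (QInfo.reduceTo₃ (QInfo.wState n hn) A B C hAB hAC hBC) ∧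
      QInfo.signal₃ (QInfo.reduceTo₃ (QInfo.wState n hn) A B C hAB hAC hBC) ≤
        4 * ((QInfo.reduceTo (QInfo.wState n hn) (A ∪ B)).entropy
          - (QInfo.reduceTo (QInfo.wState n hn) A).entropy)) := by
  refine ⟨fun T => ?_, fun A B C hAB hAC hBC hA hB hC => ⟨QInfo.signal₃_nonneg _, ?_⟩⟩
  · have hT : T.card ≤ n := by simpa using Finset.card_le_univ T
    rw [QInfo.entropy_reduceTo_wState, Nat.cast_sub hT, Real.negMulLog, Real.negMulLog]
    ring
  · have hcard : (A ∪ (B ∪ C)).card = 3 := by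
      rw [Finset.card_union_of_disjoint (Finset.disjoint_union_right.mpr ⟨hAB, hAC⟩),
        Finset.card_union_of_disjoint hBC, hA, hB, hC]
    have h3 : 3 ≤ n := by simpa [hcard] using Finset.card_le_univ (A ∪ (B ∪ C))
    have hAB2 : (A ∪ B).card = 2 := by rw [Finset.card_union_of_disjoint hAB, hA, hB]
    have hwA := QInfo.hasWeights_hammingWeight (P := A)
    have hwB := QInfo.hasWeights_hammingWeight (P := B)
    have hwC := QInfo.hasWeights_hammingWeight (P := C)
    have hwR := QInfo.hasWeights_hammingWeight (P := {i // i ∉ A ∪ (B ∪ C)})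
    rw [Fintype.card_coe] at hwA hwB hwC
    rw [hA] at hwA
    rw [hB] at hwB
    rw [hC] at hwC
    rw [Fintype.card_subtype_compl, Fintype.card_fin, Fintype.card_coe, hcard] at hwR
    have key := (QInfo.hasWFactor_reduceTo₃ hn A B C hAB hAC hBC).signal₃_le
      (fun _ _ _ => (add_assoc _ _ _).symm) hwA hwB hwC hwR
    rw [QInfo.entropy_reduceTo_wState, QInfo.entropy_reduceTo_wState, hA, hAB2]
    -- The environment consists of n - 3 qubits; `h3` makes these truncated subtractions genuine.
    have e1 : 1 + (n - 3) = n - 2 := by omega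
    have e2 : 2 + (n - 3) = n - 1 := by omega
    rwa [e1, e2] at key
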